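/- Setting. An instance consists of mutually independent random variables $P_1,\dots,P_n$, a finite indexed collection $\mathcal A$ of events, each determined by the variables, and a subset $\mathcal A'\subseteq\mathcal A$ (the core). For an event $A$ let $\mathrm{vbl}(A)$ be the smallest set of variables that determines $A$, and let $\Gamma(A)$ be the set of all $B\in\mathcal A$, $B\ne A$, with $\mathrm{vbl}(A)\cap\mathrm{vbl}(B)\neq\emptyset$. The modified Moser–Tardos (MT) algorithm samples all the variables independently; while some event of $\mathcal A'$ holds under the current assignment, it chooses such an event arbitrarily and resamples the variables of $\mathrm{vbl}$ of this event independently; it stops when no event of $\mathcal A'$ holds, and outputs the current assignment. An assignment is good if no event of $\mathcal A$ holds under it. An execution uses as $k$-th sample of $P_i$ the entry $(i,k)$ of a table of independent samples; all statements below about the algorithm hold simultaneously for all ways of making the arbitrary choices (the number of resamplings is read as its supremum over all these ways). Consider a family of instances with a size parameter that is at least $n$; each instance is presented by a finite bit string, and the values of its variables are encoded by finite bit strings. The programs are those of a multi-stack machine that reads the presentation and the current values bit by bit, has an instruction that draws a fresh sample of a variable, and takes one step per instruction or test. The cores are efficiently verifiable if one program, in a number of steps polynomial in the size and without drawing samples,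 given an arbitrary assignment finds an event $A\in\mathcal A'$ that holds (and reports $\mathrm{vbl}(A)$) or detects that there is none. Theorem. There is an absolute constant $C>0$ such that the following holds for every such family whose cores are efficiently verifiable. (i) The modified MT algorithm can be efficiently implemented: there are one program and one polynomial $q$ such that, for every instance and every table of samples for which the number of resamplings is finite, the program carries out a complete execution of the modified MT algorithm, stops with its output as the values of the variables, and takes at most $q(\text{size})\cdot(N+1)$ steps, where $N$ is the number of resamplings of this execution. (ii) Let an instance of the family, $\varepsilon\in[0,1)$ and $x:\mathcal A\to(0,1)$ be such that $$\forall A\in\mathcal A:\quad \Pr[A]\le(1-\varepsilon)\,x(A)\prod_{B\in\Gamma(A)\cap\mathcal A'}(1-x(B)).$$ Put $T=\sum_{A\in\mathcal A'}x(A)$ and $\delta=\min_{A\in\mathcal A'}x(A)\prod_{B\in\Gamma(A)\cap\mathcal A'}(1-x(B))$, and let $\log$ be the logarithm to base $2$. Then: - if $\mathrm{vbl}(A)\ne\emptyset$ for all $A\in\mathcal A'$ (and $\mathcal A'\neq\emptyset$), then $T\le n\max\{1,\log(1/\delta)\}$; - if $\varepsilon=0$, then the expected number of resamplings is at most $v_1=T\max_{A\in\mathcal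 A'}\frac1{1-x(A)}$ (read as $0$ if $\mathcal A'=\emptyset$), and for every $\lambda\ge1$ the algorithm terminates within $\lambda v_1$ resamplings with probability at least $1-1/\lambda$; - if $\varepsilon>0$, then the expected number of resamplings is at most $v_2=C\,\frac n\varepsilon\log\!\left(2+\frac T\varepsilon\right)$, and for every $\lambda\ge1$ the algorithm terminates within $\lambda v_2$ resamplings with probability at least $1-e^{-\lambda}$; - with probability at least $1-\sum_{A\in\mathcal A\setminus\mathcal A'}x(A)$ the algorithm terminates and outputs a good assignment. -/

import Mathlib

open MeasureTheory
open scoped ENNReal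

universe u v w

/-! ## The variable framework of the Lovász Local Lemma -/

/-- `n` mutually independent random variables (variable `i` takes values in `Ω i` and has law `μ i`),
a finite indexed collection `event` of bad events, and a subset `core` of it. -/
structure LLLInstance where
  n : ℕ
  Ω : Fin n → Type u
  mΩ : ∀ i, MeasurableSpace (Ω i)
  μ : ∀ i, @Measure (Ω i) (mΩ i)
  prob : ∀ i, @IsProbabilityMeasure (Ω i) (mΩ i) (μ i)
  J : Type v
  fin : Fintype J
  event : J → Set (∀ i, Ω i)
  meas : ∀ j, MeasurableSet (event j)
  core : Finset J

namespace LLLInstance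

attribute [instance] LLLInstance.mΩ LLLInstance.prob LLLInstance.fin

/-- Assignments of values to the variables. -/
abbrev Assignment (I : LLLInstance.{u, v}) : Type u := ∀ i, I.Ω i

/-- The set `B` of assignments is determined by the variables in `S`. -/
def DeterminedBy (I : LLLInstance.{u, v}) (S : Finset (Fin I.n)) (B : Set I.Assignment) : Prop :=
  ∀ ω ω' : I.Assignment, (∀ i ∈ S, ω i = ω' i) → (ω ∈ B ↔ ω' ∈ B)

open Classical in
/-- The smallest set of variables that determines `B` (see `determinedBy_vblSet`): the intersection
of all the determining sets. -/
noncomputable def vblSet (I : LLLInstance.{u, v}) (B : Set I.Assignment) : Finset (Fin I.n) :=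
  Finset.univ.filter fun i => ∀ S, I.DeterminedBy S B → i ∈ S

theorem DeterminedBy.inter (I : LLLInstance.{u, v}) {S T : Finset (Fin I.n)}
    {B : Set I.Assignment} (hS : I.DeterminedBy S B) (hT : I.DeterminedBy T B) :
    I.DeterminedBy (S ∩ T) B := by
  classical
  intro ω ω' h
  have h1 := hS ω (fun i => if i ∈ S then ω i else ω' i) (fun i hi => by simp [hi])
  have h2 := hT (fun i => if i ∈ S then ω i else ω' i) ω' (fun i hi => by
    by_cases hs : i ∈ S
    · simpa [hs] using h i (Finset.mem_inter.2 ⟨hs, hi⟩)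
    · simp [hs])
  exact h1.trans h2

theorem determinedBy_vblSet (I : LLLInstance.{u, v}) (B : Set I.Assignment) :
    I.DeterminedBy (I.vblSet B) B := by
  classical
  have key : ∀ F : Finset (Finset (Fin I.n)), (∀ S ∈ F, I.DeterminedBy S B) →
      I.DeterminedBy (F.inf id) B := by
    intro F
    induction F using Finset.induction_on with
    | empty =>
      intro _ ω ω' h
      have : ω = ω' := funext fun i => h i (by simp)
      rw [this]
    | insert S F _ ih =>
      intro h
      rw [Finset.inf_insert]
      exact DeterminedBy.inter I (h S (by simp)) (ih fun T hT => h T (by simp [hT]))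
  have h := key (Finset.univ.filter fun S => I.DeterminedBy S B) (by simp)
  have e : (Finset.univ.filter fun S => I.DeterminedBy S B).inf id = I.vblSet B := by
    ext i
    simp [vblSet, Finset.mem_inf]
  rwa [e] at h

/-- The variables that the bad event `j` depends on. -/
noncomputable def vbl (I : LLLInstance.{u, v}) (j : I.J) : Finset (Fin I.n) :=
  I.vblSet (I.event j)

open Classical in
/-- `Γ(j) ∩ core`: the core events other than `j` that share a variable with `j`. -/
noncomputable def coreNbr (I : LLLInstance.{u, v}) (j : I.J) : Finset I.J :=
  I.core.filter fun k => k ≠ j ∧ (I.vbl k ∩ I.vbl j).Nonempty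

open Classical in
/-- The bad events outside the core. -/
noncomputable def nonCore (I : LLLInstance.{u, v}) : Finset I.J :=
  Finset.univ \ I.core

/-- The probability of the bad event `j` when the variables are sampled independently. -/
noncomputable def probOf (I : LLLInstance.{u, v}) (j : I.J) : ℝ :=
  (Measure.pi I.μ).real (I.event j)

/-! ## The modified Moser–Tardos algorithm, which resamples core events only -/

/-- The random source: `R (i, k)` is the `k`-th sample drawn for variable `i`. -/
abbrev Table (I : LLLInstance.{u, v}) : Type u := ∀ p : Fin I.n × ℕ, I.Ω p.1

/-- The law of the random source: all samples are independent, those for variable `i` have law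
`μ i`. -/
noncomputable def tableLaw (I : LLLInstance.{u, v}) : Measure I.Table :=
  Measure.infinitePi fun p : Fin I.n × ℕ => I.μ p.1

open Classical in
/-- How often variable `i` is resampled if the events in the list `l` are resampled. -/
noncomputable def resampleCount (I : LLLInstance.{u, v}) (l : List I.J) (i : Fin I.n) : ℕ :=
  l.countP fun j => decide (i ∈ I.vbl j)

/-- The current assignment after the events in the list `l` have been resampled: every variable
has its most recent sample (sample number `0` is the initial one). -/
noncomputable def current (I : LLLInstance.{u, v}) (R : I.Table) (l : List I.J) : I.Assignment :=
  fun i => R (i, I.resampleCount l i)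

/-- `l` (latest event first) is the log of the resamplings of a possible partial execution of the
algorithm with the random source `R`: in every step, an arbitrary core event that holds currently
is chosen, and all the variables that it depends on are resampled. -/
inductive IsLog (I : LLLInstance.{u, v}) (R : I.Table) : List I.J → Prop
  | nil : IsLog I R []
  | cons (l : List I.J) (j : I.J) (hl : IsLog I R l) (hj : j ∈ I.core)
      (holds : I.current R l ∈ I.event j) : IsLog I R (j :: l)

/-- `l` is the log of a terminated execution: no core event holds any more. -/
def IsFinalLog (I : LLLInstance.{u, v}) (R : I.Table) (l : List I.J) : Prop :=
  I.IsLog R l ∧ ∀ j ∈ I.core, I.current R l ∉ I.event j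

/-- The number of resamplings of the algorithm with the random source `R`. The algorithm may choose
arbitrarily among the core events that hold; this is the supremum over all ways to choose, so that
it bounds the number of resamplings under every rule of choice. -/
noncomputable def resamplings (I : LLLInstance.{u, v}) (R : I.Table) : ℕ∞ :=
  ⨆ l : {l : List I.J // I.IsLog R l}, (l.1.length : ℕ∞)

/-- The random sources with which the algorithm terminates and outputs a good assignment (one that
avoids all bad events, core or not), however it chooses among the core events that hold. -/
def successSet (I : LLLInstance.{u, v}) : Set I.Table :=
  {R | I.resamplings R < ⊤ ∧ ∀ l, I.IsFinalLog R l → ∀ j, I.current R l ∉ I.event j}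

/-! ## Quantities in the running time -/

/-- The sum of `x` over the core. -/
noncomputable def T (I : LLLInstance.{u, v}) (x : I.J → ℝ) : ℝ := ∑ j ∈ I.core, x j

/-- The minimum over core events `j` of `x j * ∏ (1 - x k)`, over the core neighbours `k` of `j`. -/
noncomputable def δ (I : LLLInstance.{u, v}) (x : I.J → ℝ) : ℝ :=
  ⨅ j : I.core, x j * ∏ k ∈ I.coreNbr j, (1 - x k)

/-- The bound without slack. -/
noncomputable def v₁ (I : LLLInstance.{u, v}) (x : I.J → ℝ) : ℝ :=
  I.T x * ⨆ j : I.core, 1 / (1 - x j)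

/-- The bound with slack `ε`, up to a constant factor. The `2 +` only keeps the logarithm
positive: for `T / ε ≥ 2` it changes the bound by a factor of at most two. -/
noncomputable def v₂ (I : LLLInstance.{u, v}) (x : I.J → ℝ) (ε : ℝ) : ℝ :=
  I.n / ε * Real.logb 2 (2 + I.T x / ε)

end LLLInstance

/-! ## A machine model with a step count

Structured programs on finitely many stacks of bits (a multitape Turing machine up to a polynomial
in the number of steps), with bitwise read access to a description of the instance and to the
current values of the variables, and with an instruction that draws a fresh sample of a variable.
A number that an instruction takes is the height of a stack. -/

/-- Tests: the stack `s` is nonempty, or has the bit `true` on top. -/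
inductive StackTest
  | nonempty (s : ℕ)
  | top (s : ℕ)

/-- Programs. Stacks are named by natural numbers; every program names finitely many of them. -/
inductive Prog
  | skip
  | push (s : ℕ) (b : Bool)
  | pop (s : ℕ)
  /-- push on `s` the bit of the description at position `height of a`, if there is one -/
  | readInput (s a : ℕ)
  /-- push on `s` the bit at position `height of b` of the value of the variable with number
  `height of a`, if there is one -/
  | readValue (s a b : ℕ)
  /-- push on `s` whether the height of `a` is the number of a variable -/
  | isVar (s a : ℕ)
  /-- draw a fresh sample of the variable with number `height of a`, if there is one -/
  | sample (a : ℕ)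
  | seq (p q : Prog)
  | ite (t : StackTest) (p q : Prog)
  | while (t : StackTest) (p : Prog)

/-- A representation of an instance by bit strings: a description of the instance, and an encoding
of the values of each variable. -/
structure Presentation (I : LLLInstance.{u, v}) where
  desc : List Bool
  enc : ∀ i, I.Ω i → List Bool

/-- Machine states: the stacks (top first), the current values of the variables, and the number of
samples drawn of each variable. -/
structure MState (I : LLLInstance.{u, v}) where
  stk : ℕ → List Bool
  val : I.Assignment
  drawn : Fin I.n → ℕ

namespace MState

variable {I : LLLInstance.{u, v}}

/-- The state with empty stacks. -/
def blank (ω : I.Assignment) (d : Fin I.n → ℕ) : MState I := ⟨fun _ => [], ω, d⟩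

def setStk (σ : MState I) (s : ℕ) (l : List Bool) : MState I :=
  { σ with stk := Function.update σ.stk s l }

def pushOpt (σ : MState I) (s : ℕ) (b : Option Bool) : MState I :=
  σ.setStk s (b.toList ++ σ.stk s)

/-- The bit at position `k` of the value of the variable number `a`. -/
def valueBit (P : Presentation I) (σ : MState I) (a k : ℕ) : Option Bool :=
  if h : a < I.n then (P.enc ⟨a, h⟩ (σ.val ⟨a, h⟩))[k]? else none

/-- Replace the value of the variable number `a` by its next sample from the random source. -/
def draw (R : I.Table) (σ : MState I) (a : ℕ) : MState I :=
  if h : a < I.n then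
    { σ with
      val := Function.update σ.val ⟨a, h⟩ (R (⟨a, h⟩, σ.drawn ⟨a, h⟩))
      drawn := Function.update σ.drawn ⟨a, h⟩ (σ.drawn ⟨a, h⟩ + 1) }
  else σ

end MState

def StackTest.eval {I : LLLInstance.{u, v}} (σ : MState I) : StackTest → Bool
  | .nonempty s => !(σ.stk s).isEmpty
  | .top s => (σ.stk s).head? == some true

/-- `Runs P R p σ t σ'`: started in the state `σ`, the program `p` halts after `t` steps in the
state `σ'`. Every instruction and every evaluation of a test takes one step. -/
inductive Runs {I : LLLInstance.{u, v}} (P : Presentation I) (R : I.Table) :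
    Prog → MState I → ℕ → MState I → Prop
  | skip (σ : MState I) : Runs P R .skip σ 1 σ
  | push (s : ℕ) (b : Bool) (σ : MState I) : Runs P R (.push s b) σ 1 (σ.pushOpt s (some b))
  | pop (s : ℕ) (σ : MState I) : Runs P R (.pop s) σ 1 (σ.setStk s (σ.stk s).tail)
  | readInput (s a : ℕ) (σ : MState I) :
      Runs P R (.readInput s a) σ 1 (σ.pushOpt s P.desc[(σ.stk a).length]?)
  | readValue (s a b : ℕ) (σ : MState I) :
      Runs P R (.readValue s a b) σ 1
        (σ.pushOpt s (σ.valueBit P (σ.stk a).length (σ.stk b).length))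
  | isVar (s a : ℕ) (σ : MState I) :
      Runs P R (.isVar s a) σ 1 (σ.pushOpt s (some (decide ((σ.stk a).length < I.n))))
  | sample (a : ℕ) (σ : MState I) : Runs P R (.sample a) σ 1 (σ.draw R (σ.stk a).length)
  | seq (p q : Prog) (σ σ₁ σ₂ : MState I) (t₁ t₂ : ℕ) (hp : Runs P R p σ t₁ σ₁)
      (hq : Runs P R q σ₁ t₂ σ₂) : Runs P R (.seq p q) σ (t₁ + t₂) σ₂
  | iteTrue (c : StackTest) (p q : Prog) (σ σ' : MState I) (t : ℕ) (hc : c.eval σ = true)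
      (hp : Runs P R p σ t σ') : Runs P R (.ite c p q) σ (1 + t) σ'
  | iteFalse (c : StackTest) (p q : Prog) (σ σ' : MState I) (t : ℕ) (hc : c.eval σ = false)
      (hq : Runs P R q σ t σ') : Runs P R (.ite c p q) σ (1 + t) σ'
  | whileFalse (c : StackTest) (p : Prog) (σ : MState I) (hc : c.eval σ = false) :
      Runs P R (.while c p) σ 1 σ
  | whileTrue (c : StackTest) (p : Prog) (σ σ₁ σ₂ : MState I) (t₁ t₂ : ℕ) (hc : c.eval σ = true)
      (hp : Runs P R p σ t₁ σ₁) (hw : Runs P R (.while c p) σ₁ t₂ σ₂) :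
      Runs P R (.while c p) σ (1 + t₁ + t₂) σ₂

/-! ## Efficient verifiability and efficient implementation -/

open Classical in
/-- On every assignment, and from empty stacks, the program `V` halts within `t` steps without
having drawn samples, and either finds a core event that holds or detects that there is none. It
answers with the top bit of stack `0`; the event that it finds is reported by the bit vector, on
stack `1`, of the set of variables that it depends on. -/
def FindsCoreEvent {I : LLLInstance.{u, v}} (P : Presentation I) (V : Prog) (t : ℕ) : Prop :=
  ∀ (R : I.Table) (ω : I.Assignment) (d : Fin I.n → ℕ), ∃ (k : ℕ) (σ : MState I),
    k ≤ t ∧ Runs P R V (MState.blank ω d) k σ ∧ σ.val = ω ∧ σ.drawn = d ∧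
    ((∃ j ∈ I.core, ω ∈ I.event j ∧ (σ.stk 0).head? = some true ∧
        σ.stk 1 = List.ofFn fun i => decide (i ∈ I.vbl j)) ∨
      ((∀ j ∈ I.core, ω ∉ I.event j) ∧ (σ.stk 0).head? ≠ some true))

/-- The cores of a family of instances are efficiently verifiable: one program, in a number of
steps that is polynomial in the size, finds a core event that holds or detects that none does. -/
def EfficientlyVerifiable {ι : Type w} (F : ι → LLLInstance.{u, v})
    (P : ∀ a, Presentation (F a)) (size : ι → ℕ) : Prop :=
  ∃ (V : Prog) (p : Polynomial ℕ), ∀ a, FindsCoreEvent (P a) V (p.eval (size a))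

/-- The modified Moser–Tardos algorithm can be efficiently implemented on a family of instances:
one program, from any initial values of the variables, carries out a complete execution of the
algorithm and stops with its output as the values of the variables, in a number of steps that is at
most a polynomial in the size, times one plus the number of resamplings of that execution. -/
def EfficientlyImplementable {ι : Type w} (F : ι → LLLInstance.{u, v})
    (P : ∀ a, Presentation (F a)) (size : ι → ℕ) : Prop :=
  ∃ (M : Prog) (q : Polynomial ℕ), ∀ (a : ι) (R : (F a).Table) (ω₀ : (F a).Assignment),
    (F a).resamplings R < ⊤ →
    ∃ (l : List (F a).J) (t : ℕ) (σ : MState (F a)), (F a).IsFinalLog R l ∧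
      Runs (P a) R M (MState.blank ω₀ fun _ => 0) t σ ∧ σ.val = (F a).current R l ∧
      t ≤ q.eval (size a) * (l.length + 1)

/-!
Going back in time through a log of resamplings, one reads off a history: a sequence of layers of
pairwise independent events, each event of a layer depending on an event of the next later layer
(the stable set sequences of Kolipaka and Szegedy). Every resampling, and every occurrence of an
event outside the core, is the end of such a history. The events of a history are decided by
disjoint sets of table entries, so the probability that it occurs is at most the product of the
probabilities of its events. With `y = x / (1 - x)`, the sum of these products is bounded layer by
layer, since the sum of `∏ j ∈ L, y j` over the sets `L` of core neighbours is `∏ (1 + y j)`, the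
inverse of the product of the `1 - x j`.

If `ε > 0`, replacing `x` by `(1 - ε / 2) x` keeps `x` away from `1` and leaves a factor
`1 - ε / 2` per event of a history. A long execution resamples some variable often, and then has
a long history ending in an event of that variable, which gives the exponential tail.

The implementation runs the verifier, redraws the variables of the reported event, and clears the
stacks before the next round.
-/

section Traces

variable {α : Type*}

/-- Mazurkiewicz trace equivalence for the dependence relation `D`: two words are equivalent if
they differ by transpositions of adjacent independent letters. -/
inductive TraceEq (D : α → α → Prop) : List α → List α → Prop
  | refl (l : List α) : TraceEq D l l
  | cons (a : α) {l l' : List α} (h : TraceEq D l l') : TraceEq D (a :: l) (a :: l')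
  | swap {a b : α} (h : ¬ D a b) (l : List α) : TraceEq D (b :: a :: l) (a :: b :: l)
  | trans {l₁ l₂ l₃ : List α} (h : TraceEq D l₁ l₂) (h' : TraceEq D l₂ l₃) : TraceEq D l₁ l₃

namespace TraceEq

variable {D : α → α → Prop} {l l' : List α}

theorem perm (h : TraceEq D l l') : l.Perm l' := by
  induction h with
  | refl l => exact .refl l
  | cons a _ ih => exact ih.cons a
  | swap _ l => exact .swap _ _ l
  | trans _ _ ih ih' => exact ih.trans ih'

theorem append_left (m : List α) (h : TraceEq D l l') : TraceEq D (m ++ l) (m ++ l') := by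
  induction m with
  | nil => exact h
  | cons a m ih => exact ih.cons a

theorem append_right (m : List α) (h : TraceEq D l l') : TraceEq D (l ++ m) (l' ++ m) := by
  induction h with
  | refl l => exact .refl _
  | cons a _ ih => exact ih.cons a
  | swap h l => exact .swap h (l ++ m)
  | trans _ _ ih ih' => exact ih.trans ih'

theorem append_singleton {b : α} (h : ∀ c ∈ l, ¬ D b c) : TraceEq D (l ++ [b]) (b :: l) := by
  induction l with
  | nil => exact .refl _
  | cons c l ih =>
    rw [List.forall_mem_cons] at h
    exact ((ih h.2).cons c).trans (.swap h.1 l)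

theorem of_perm [Std.Symm D] (h : l.Perm l') (hl : l.Pairwise fun a b => ¬ D a b) :
    TraceEq D l l' := by
  induction h with
  | nil => exact .refl _
  | cons a _ ih => exact (ih hl.of_cons).cons a
  | swap a b l => exact .swap (fun h => (List.pairwise_cons.1 hl).1 a (by simp) (symm h)) l
  | trans h _ ih ih' => exact (ih hl).trans (ih' (h.pairwise hl fun h => mt symm h))

end TraceEq

variable (D : α → α → Prop) (S : Finset α)

open Classical in
/-- The letters in `S` that depend on a letter in `L`. -/
noncomputable def depNbr (L : Finset α) : Finset α := S.filter fun b => ∃ a ∈ L, D b a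

/-- The relation between consecutive layers of a history (a stable set sequence of Kolipaka and
Szegedy): every letter of the layer `M` depends on a letter of the layer `L`, which comes later in
time, and the letters of `M` are independent. -/
structure Follows (L M : Finset α) : Prop where
  nonempty : M.Nonempty
  subset : M ⊆ depNbr D S L
  pairwise : (M : Set α).Pairwise fun a b => ¬ D a b

/-- The word spelled by a sequence of layers. -/
noncomputable def layerWord (τ : List (Finset α)) : List α := τ.flatMap Finset.toList

open Classical in
/-- Add the letter `b` to a sequence of layers: as a layer of its own after the last layer on which
`b` depends, unless there is a layer there already, which it then joins. -/
noncomputable def attach (b : α) : List (Finset α) → List (Finset α)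
  | [] => [{b}]
  | M :: τ => if ∃ c ∈ layerWord (M :: τ), D b c then M :: attach b τ else insert b M :: τ

variable {D S}

@[simp] theorem layerWord_nil : layerWord ([] : List (Finset α)) = [] := rfl

@[simp] theorem layerWord_cons (L : Finset α) (τ : List (Finset α)) :
    layerWord (L :: τ) = L.toList ++ layerWord τ := rfl

theorem mem_depNbr {L : Finset α} {b : α} : b ∈ depNbr D S L ↔ b ∈ S ∧ ∃ a ∈ L, D b a := by
  simp only [depNbr, Finset.mem_filter]

theorem depNbr_mono : Monotone (depNbr D S) := fun _ _ h _ hb =>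
  have ⟨hS, a, ha, hba⟩ := mem_depNbr.1 hb
  mem_depNbr.2 ⟨hS, a, h ha, hba⟩

theorem Follows.mono_left {L L' M : Finset α} (h : Follows D S L M) (hL : L ⊆ L') :
    Follows D S L' M := ⟨h.nonempty, h.subset.trans (depNbr_mono hL), h.pairwise⟩

section Attach

variable [Std.Symm D] {b : α} {L : Finset α} {τ : List (Finset α)}

open Classical in
theorem Follows.insert {M : Finset α} (hb : b ∈ S) (hL : ∃ c ∈ L, D b c)
    (hM : M ⊆ depNbr D S L) (hM' : (M : Set α).Pairwise fun a c => ¬ D a c)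
    (h : ∀ c ∈ M, ¬ D b c) : Follows D S L (insert b M) where
  nonempty := Finset.insert_nonempty _ _
  subset := Finset.insert_subset (mem_depNbr.2 ⟨hb, hL⟩) hM
  pairwise := by
    rw [Finset.coe_insert]
    exact hM'.insert fun c hc _ => ⟨h c hc, mt symm (h c hc)⟩

theorem isChain_attach (hb : b ∈ S) (hτ : (L :: τ).IsChain (Follows D S))
    (h : ∃ c ∈ layerWord (L :: τ), D b c) : (L :: attach D b τ).IsChain (Follows D S) := by
  classical
  induction τ generalizing L with
  | nil =>
    simp only [layerWord_cons, layerWord_nil, List.append_nil, Finset.mem_toList] at h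
    simpa [attach] using Follows.insert hb h (Finset.empty_subset _) (by simp) (by simp)
  | cons M τ ih =>
    obtain ⟨hLM, hMτ⟩ := List.isChain_cons_cons.1 hτ
    by_cases hM : ∃ c ∈ layerWord (M :: τ), D b c
    · rw [attach, if_pos hM]
      exact List.isChain_cons_cons.2 ⟨hLM, ih hMτ hM⟩
    · rw [attach, if_neg hM]
      have hL : ∃ c ∈ L, D b c := by
        obtain ⟨c, hc, hbc⟩ := h
        rw [layerWord_cons, List.mem_append, Finset.mem_toList] at hc
        exact ⟨c, hc.resolve_right fun hc => hM ⟨c, hc, hbc⟩, hbc⟩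
      have hbM : ∀ c ∈ M, ¬ D b c := fun c hc hbc => hM ⟨c, by simp [hc], hbc⟩
      refine List.isChain_cons_cons.2 ⟨.insert hb hL hLM.subset hLM.pairwise hbM, ?_⟩
      rw [List.isChain_cons] at hMτ ⊢
      exact ⟨fun K hK => (hMτ.1 K hK).mono_left (Finset.subset_insert _ _), hMτ.2⟩

theorem traceEq_layerWord_attach [Std.Refl D] (hτ : (L :: τ).IsChain (Follows D S)) :
    TraceEq D (layerWord τ ++ [b]) (layerWord (attach D b τ)) := by
  classical
  induction τ generalizing L with
  | nil => simpa [attach] using TraceEq.refl _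
  | cons M τ ih =>
    obtain ⟨hLM, hMτ⟩ := List.isChain_cons_cons.1 hτ
    by_cases hM : ∃ c ∈ layerWord (M :: τ), D b c
    · rw [attach, if_pos hM, layerWord_cons, layerWord_cons, List.append_assoc]
      exact (ih hMτ).append_left _
    · rw [attach, if_neg hM]
      push Not at hM
      have hbM : ∀ c ∈ M, ¬ D b c := fun c hc => hM c (by simp [hc])
      have h_indep : (b :: M.toList).Pairwise fun a c => ¬ D a c := by
        refine List.pairwise_cons.2 ⟨by simpa using hbM, ?_⟩
        exact M.nodup_toList.imp_of_mem fun ha hc =>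
          hLM.pairwise (Finset.mem_toList.1 ha) (Finset.mem_toList.1 hc)
      have h_insert : TraceEq D (b :: M.toList) (insert b M).toList :=
        .of_perm (Finset.toList_insert fun hb => hbM b hb (refl b)).symm h_indep
      exact (TraceEq.append_singleton hM).trans (h_insert.append_right _)

end Attach

/-- Going back in time through `l`, a letter either joins the history of `a` or commutes with all of
it. -/
theorem exists_history [Std.Refl D] [Std.Symm D] (a : α) (l : List α) (hl : ∀ b ∈ l, b ∈ S) :
    ∃ (τ : List (Finset α)) (d : List α), ({a} :: τ).IsChain (Follows D S) ∧
      TraceEq D (a :: l) (d ++ layerWord ({a} :: τ)) ∧ ∀ c ∈ d, ¬ D a c := by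
  induction l using List.reverseRecOn with
  | nil => exact ⟨[], [], by simp, by simpa using .refl _, by simp⟩
  | append_singleton l b ih =>
    obtain ⟨τ, d, hτ, h_eq, hd⟩ := ih fun c hc => hl c (by simp [hc])
    have hb : b ∈ S := hl b (by simp)
    by_cases hdep : ∃ c ∈ layerWord ({a} :: τ), D b c
    · refine ⟨attach D b τ, d, isChain_attach hb hτ hdep, ?_, hd⟩
      refine (h_eq.append_right [b]).trans ?_
      simpa using ((traceEq_layerWord_attach hτ).append_left [a]).append_left d
    · push Not at hdep
      refine ⟨τ, d ++ [b], hτ, ?_, ?_⟩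
      · refine (h_eq.append_right [b]).trans ?_
        simpa using (TraceEq.append_singleton hdep).append_left d
      · have hab : ¬ D a b := mt symm (hdep a (by simp))
        simpa [or_imp, forall_and] using ⟨hd, hab⟩

end Traces

section HistorySums

theorem prod_biUnion_le_prod_prod {α β M : Type*} [CommMonoid M] [Preorder M] [MulLeftMono M]
    [DecidableEq β] (s : Finset α) (t : α → Finset β) {f : β → M} (hf : ∀ b, 1 ≤ f b) :
    ∏ b ∈ s.biUnion t, f b ≤ ∏ a ∈ s, ∏ b ∈ t a, f b := by
  classical
  induction s using Finset.induction_on with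
  | empty => simp
  | insert a s ha ih =>
    rw [Finset.biUnion_insert, Finset.prod_insert ha]
    calc ∏ b ∈ t a ∪ s.biUnion t, f b
        ≤ (∏ b ∈ t a ∪ s.biUnion t, f b) * ∏ b ∈ t a ∩ s.biUnion t, f b :=
          le_mul_of_one_le_right' (Finset.one_le_prod' fun b _ => hf b)
      _ = (∏ b ∈ t a, f b) * ∏ b ∈ s.biUnion t, f b := Finset.prod_union_inter
      _ ≤ _ := mul_le_mul_right ih _

variable {α : Type*} (D : α → α → Prop) (S : Finset α)

/-- The layers that precede the latest layer `{a}` in a history of the letter `a`. -/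
def tails (a : α) : Set (List (Finset α)) := {τ | ({a} :: τ).IsChain (Follows D S)}

open Classical in
/-- A finite set that contains the sequences of at most `k` layers that continue a history with
earliest layer `L`. -/
noncomputable def continuations : ℕ → Finset α → Finset (List (Finset α))
  | 0, _ => {[]}
  | k + 1, L => insert [] ((((depNbr D S L).powerset.erase ∅).sigma fun M =>
      continuations k M).image fun p => p.1 :: p.2)

variable {D S}

theorem mem_continuations {k : ℕ} {L : Finset α} {τ : List (Finset α)}
    (h : (L :: τ).IsChain (Follows D S)) (hk : τ.length ≤ k) : τ ∈ continuations D S k L := by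
  classical
  induction k generalizing L τ with
  | zero =>
    rw [List.eq_nil_of_length_eq_zero (Nat.le_zero.1 hk)]
    exact Finset.mem_singleton_self _
  | succ k ih =>
    cases τ with
    | nil => exact Finset.mem_insert_self _ _
    | cons M τ =>
      obtain ⟨hLM, hMτ⟩ := List.isChain_cons_cons.1 h
      refine Finset.mem_insert_of_mem
        (Finset.mem_image.2 ⟨⟨M, τ⟩, Finset.mem_sigma.2 ⟨?_, ?_⟩, rfl⟩)
      · exact Finset.mem_erase.2 ⟨hLM.nonempty.ne_empty, Finset.mem_powerset.2 hLM.subset⟩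
      · exact ih hMτ (Nat.le_of_succ_le_succ hk)

variable {q y : α → ℝ≥0∞}

theorem prod_mul_prod_depNbr_le (h : ∀ b ∈ S, q b * ∏ c ∈ depNbr D S {b}, (1 + y c) ≤ y b)
    {L : Finset α} (hL : L ⊆ S) :
    (∏ a ∈ L, q a) * ∏ c ∈ depNbr D S L, (1 + y c) ≤ ∏ a ∈ L, y a := by
  classical
  have h_biUnion : depNbr D S L = L.biUnion fun a => depNbr D S {a} := by
    ext b
    simp only [mem_depNbr, Finset.mem_biUnion, Finset.mem_singleton, exists_eq_left]
    tauto
  calc (∏ a ∈ L, q a) * ∏ c ∈ depNbr D S L, (1 + y c)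
      ≤ (∏ a ∈ L, q a) * ∏ a ∈ L, ∏ c ∈ depNbr D S {a}, (1 + y c) := by
        rw [h_biUnion]
        gcongr
        exact prod_biUnion_le_prod_prod _ _ fun _ => le_self_add
    _ = ∏ a ∈ L, (q a * ∏ c ∈ depNbr D S {a}, (1 + y c)) := Finset.prod_mul_distrib.symm
    _ ≤ ∏ a ∈ L, y a := Finset.prod_le_prod' fun a ha => h a (hL ha)

theorem prod_layerWord_cons (L : Finset α) (τ : List (Finset α)) :
    ((layerWord (L :: τ)).map q).prod = (∏ a ∈ L, q a) * ((layerWord τ).map q).prod := by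
  rw [layerWord_cons, List.map_append, List.prod_append, Finset.prod_map_toList]

theorem sum_continuations_le (h : ∀ b ∈ S, q b * ∏ c ∈ depNbr D S {b}, (1 + y c) ≤ y b) (k : ℕ)
    (L : Finset α) :
    ∑ τ ∈ continuations D S k L, ((layerWord τ).map q).prod ≤ ∏ c ∈ depNbr D S L, (1 + y c) := by
  classical
  induction k generalizing L with
  | zero =>
    rw [continuations, Finset.sum_singleton, layerWord_nil, List.map_nil, List.prod_nil]
    exact Finset.one_le_prod' fun _ _ => le_self_add
  | succ k ih =>
    have h_layer : ∀ M ∈ (depNbr D S L).powerset.erase ∅,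
        ∑ τ ∈ continuations D S k M, ((layerWord (M :: τ)).map q).prod ≤ ∏ c ∈ M, y c := by
      intro M hM
      have hMS : M ⊆ S := fun b hb =>
        (mem_depNbr.1 (Finset.mem_powerset.1 (Finset.mem_of_mem_erase hM) hb)).1
      simp only [prod_layerWord_cons, ← Finset.mul_sum]
      exact (mul_le_mul_right (ih M) _).trans (prod_mul_prod_depNbr_le h hMS)
    calc ∑ τ ∈ continuations D S (k + 1) L, ((layerWord τ).map q).prod
        = 1 + ∑ M ∈ (depNbr D S L).powerset.erase ∅, ∑ τ ∈ continuations D S k M,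
            ((layerWord (M :: τ)).map q).prod := by
          rw [continuations, Finset.sum_insert (by simp), Finset.sum_image, Finset.sum_sigma]
          · simp
          · rintro ⟨M, τ⟩ _ ⟨M', τ'⟩ _ h_eq
            simpa using h_eq
      _ ≤ 1 + ∑ M ∈ (depNbr D S L).powerset.erase ∅, ∏ c ∈ M, y c := by
          gcongr with M hM
          exact h_layer M hM
      _ = ∏ c ∈ depNbr D S L, (1 + y c) := by
          rw [Finset.prod_one_add, ← Finset.add_sum_erase _ _ (Finset.empty_mem_powerset _),
            Finset.prod_empty]

theorem tsum_tails_le (h : ∀ b ∈ S, q b * ∏ c ∈ depNbr D S {b}, (1 + y c) ≤ y b) (a : α) :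
    ∑' τ : tails D S a, ((layerWord ({a} :: τ.1)).map q).prod ≤
      q a * ∏ c ∈ depNbr D S {a}, (1 + y c) := by
  classical
  simp only [prod_layerWord_cons, Finset.prod_singleton, ENNReal.tsum_mul_left]
  gcongr
  rw [ENNReal.tsum_eq_iSup_sum]
  refine iSup_le fun s => ?_
  let k := s.sup fun τ => τ.1.length
  have h_subset : s.image Subtype.val ⊆ continuations D S k {a} := by
    intro τ hτ
    obtain ⟨τ, hs, rfl⟩ := Finset.mem_image.1 hτ
    exact mem_continuations τ.2 (Finset.le_sup (f := fun τ : tails D S a => τ.1.length) hs)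
  rw [← Finset.sum_image (f := fun τ => ((layerWord τ).map q).prod) (g := Subtype.val) (by simp)]
  exact (Finset.sum_le_sum_of_subset h_subset).trans (sum_continuations_le h k {a})

theorem tsum_long_tails_le {c : ℝ≥0∞} (hc₀ : c ≠ 0) (hc₁ : c ≤ 1)
    (h : ∀ b ∈ S, q b * ∏ d ∈ depNbr D S {b}, (1 + y d) ≤ c * y b) {a : α} (ha : a ∈ S) (s : ℕ) :
    ∑' τ : {τ : tails D S a // s ≤ (layerWord ({a} :: τ.1)).length},
        ((layerWord ({a} :: τ.1.1)).map q).prod ≤ c ^ s * y a := by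
  have hc_top : c ≠ ⊤ := (hc₁.trans_lt ENNReal.one_lt_top).ne
  let q' : α → ℝ≥0∞ := fun b => c⁻¹ * q b
  have hq : q = fun b => c * q' b := funext fun b => (ENNReal.mul_inv_cancel_left hc₀ hc_top).symm
  have h' : ∀ b ∈ S, q' b * ∏ d ∈ depNbr D S {b}, (1 + y d) ≤ y b := fun b hb => by
    rw [mul_assoc, ENNReal.inv_mul_le_iff hc₀ hc_top]
    exact h b hb
  calc ∑' τ : {τ : tails D S a // s ≤ (layerWord ({a} :: τ.1)).length},
        ((layerWord ({a} :: τ.1.1)).map q).prod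
      ≤ ∑' τ : {τ : tails D S a // s ≤ (layerWord ({a} :: τ.1)).length},
          c ^ s * ((layerWord ({a} :: τ.1.1)).map q').prod := by
        refine ENNReal.tsum_le_tsum fun τ => ?_
        rw [hq, List.prod_map_mul, List.map_const', List.prod_replicate]
        gcongr ?_ * _
        exact pow_le_pow_right_of_le_one' hc₁ τ.2
    _ ≤ c ^ s * ∑' τ : tails D S a, ((layerWord ({a} :: τ.1)).map q').prod := by
        rw [ENNReal.tsum_mul_left]
        gcongr
        exact ENNReal.tsum_comp_le_tsum_of_injective Subtype.val_injective
          fun τ : tails D S a => ((layerWord ({a} :: τ.1)).map q').prod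
    _ ≤ c ^ s * y a := by
        gcongr
        exact (tsum_tails_le h' a).trans (h' a ha)

end HistorySums

namespace LLLInstance

/-- Two events are dependent if they are equal or share a variable. -/
def Dep (I : LLLInstance.{u, v}) (a b : I.J) : Prop := a = b ∨ (I.vbl a ∩ I.vbl b).Nonempty

/-- Every event in the list `l` (latest event first) holds at the time at which it is resampled. -/
def Consistent (I : LLLInstance.{u, v}) (R : I.Table) : List I.J → Prop
  | [] => True
  | j :: l => I.current R l ∈ I.event j ∧ Consistent I R l

variable {I : LLLInstance.{u, v}}

instance : Std.Refl I.Dep := ⟨fun _ => Or.inl rfl⟩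

instance : Std.Symm I.Dep := ⟨fun a b h => by rwa [Dep, eq_comm, Finset.inter_comm]⟩

theorem not_mem_vbl_of_not_dep {a b : I.J} (h : ¬ I.Dep a b) {i : Fin I.n} (hi : i ∈ I.vbl a) :
    i ∉ I.vbl b := fun hb => h (Or.inr ⟨i, Finset.mem_inter.2 ⟨hi, hb⟩⟩)

theorem resampleCount_cons (j : I.J) (l : List I.J) (i : Fin I.n) :
    I.resampleCount (j :: l) i = I.resampleCount l i + if i ∈ I.vbl j then 1 else 0 := by
  simp [resampleCount, List.countP_cons]

theorem resampleCount_append (l l' : List I.J) (i : Fin I.n) :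
    I.resampleCount (l ++ l') i = I.resampleCount l i + I.resampleCount l' i :=
  List.countP_append

theorem resampleCount_perm {l l' : List I.J} (h : l.Perm l') :
    I.resampleCount l = I.resampleCount l' := funext fun _ => h.countP_eq _

theorem current_perm (R : I.Table) {l l' : List I.J} (h : l.Perm l') :
    I.current R l = I.current R l' := by
  unfold current
  rw [resampleCount_perm h]

theorem current_cons_mem_event {R : I.Table} {a b : I.J} (h : ¬ I.Dep a b) (l : List I.J) :
    I.current R (b :: l) ∈ I.event a ↔ I.current R l ∈ I.event a := by
  refine I.determinedBy_vblSet (I.event a) _ _ fun i hi => ?_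
  rw [current, current, resampleCount_cons, if_neg (not_mem_vbl_of_not_dep h hi), add_zero]

theorem Consistent.of_append {R : I.Table} {l m : List I.J} (h : I.Consistent R (l ++ m)) :
    I.Consistent R m := by
  induction l with
  | nil => exact h
  | cons a l ih => exact ih h.2

theorem Consistent.of_traceEq {R : I.Table} {l l' : List I.J} (h : I.Consistent R l)
    (hl : TraceEq I.Dep l l') : I.Consistent R l' := by
  induction hl with
  | refl l => exact h
  | cons a hl ih =>
    exact ⟨current_perm R hl.perm ▸ h.1, ih h.2⟩
  | swap hab l =>
    obtain ⟨hb, ha, hl⟩ := h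
    exact ⟨(current_cons_mem_event hab l).2 ha, (current_cons_mem_event (mt symm hab) l).1 hb, hl⟩
  | trans _ _ ih ih' => exact ih' (ih h)

theorem isLog_iff {R : I.Table} {l : List I.J} :
    I.IsLog R l ↔ I.Consistent R l ∧ ∀ j ∈ l, j ∈ I.core := by
  constructor
  · intro h
    induction h with
    | nil => exact ⟨trivial, by simp⟩
    | cons l j _ hj holds ih => exact ⟨⟨holds, ih.1⟩, List.forall_mem_cons.2 ⟨hj, ih.2⟩⟩
  · rintro ⟨h, hc⟩
    induction l with
    | nil => exact .nil
    | cons j l ih =>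
      rw [List.forall_mem_cons] at hc
      exact .cons l j (ih h.2 hc.2) hc.1 h.1

theorem IsLog.of_append {R : I.Table} {l m : List I.J} (h : I.IsLog R (l ++ m)) : I.IsLog R m := by
  rw [isLog_iff] at h ⊢
  exact ⟨h.1.of_append, fun j hj => h.2 j (List.mem_append_right l hj)⟩

open Classical in
theorem exists_tail_of_isLog {R : I.Table} {a : I.J} {l : List I.J} (hl : I.IsLog R l)
    (ha : I.current R l ∈ I.event a) :
    ∃ τ ∈ tails I.Dep I.core a, I.Consistent R (layerWord ({a} :: τ)) ∧
      (layerWord ({a} :: τ)).count a = (a :: l).count a ∧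
      ∀ i ∈ I.vbl a, I.resampleCount (a :: l) i ≤ (layerWord ({a} :: τ)).length := by
  obtain ⟨hR, hcore⟩ := isLog_iff.1 hl
  obtain ⟨τ, d, hτ, h_eq, hd⟩ := exists_history (D := I.Dep) a l hcore
  have hR' : I.Consistent R (a :: l) := ⟨ha, hR⟩
  refine ⟨τ, hτ, (hR'.of_traceEq h_eq).of_append, ?_, fun i hi => ?_⟩
  · have hda : d.count a = 0 := List.count_eq_zero_of_not_mem fun ha => hd a ha (refl a)
    rw [h_eq.perm.count_eq, List.count_append, hda, zero_add]
  · have hdi : I.resampleCount d i = 0 := List.countP_eq_zero.2 fun c hc => by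
      simpa using not_mem_vbl_of_not_dep (hd c hc) hi
    rw [resampleCount_perm h_eq.perm, resampleCount_append, hdi, zero_add]
    exact List.countP_le_length

end LLLInstance

section CylinderEvents

variable {ι : Type*} {Ω : ι → Type*} [∀ i, MeasurableSpace (Ω i)]

theorem indep_cylinderEvents (P : ∀ i, Measure (Ω i)) [∀ i, IsProbabilityMeasure (P i)]
    {S S' : Set ι} (h : Disjoint S S') :
    ProbabilityTheory.Indep (cylinderEvents S) (cylinderEvents S') (Measure.infinitePi P) := by
  have h_indep : ProbabilityTheory.iIndepFun (fun i (ω : ∀ i, Ω i) => ω i) (Measure.infinitePi P) :=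
    ProbabilityTheory.iIndepFun_infinitePi (X := fun _ ω => ω) (by fun_prop)
  exact ProbabilityTheory.indep_iSup_of_disjoint
    (fun i => (measurable_pi_apply i).comap_le) h_indep h

/-- The coordinates outside `S` may be frozen at an arbitrary point. -/
theorem measurableSet_cylinderEvents {S : Set ι} {B : Set (∀ i, Ω i)} (hB : MeasurableSet B)
    (h : ∀ ω ω' : ∀ i, Ω i, (∀ i ∈ S, ω i = ω' i) → (ω ∈ B ↔ ω' ∈ B)) :
    MeasurableSet[cylinderEvents S] B := by
  classical
  rcases isEmpty_or_nonempty (∀ i, Ω i) with _ | ⟨⟨ω₀⟩⟩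
  · rw [Set.eq_empty_of_isEmpty B]
    exact @MeasurableSet.empty _ (cylinderEvents S)
  let freeze : (∀ i, Ω i) → ∀ i, Ω i := fun ω i => if i ∈ S then ω i else ω₀ i
  have h_freeze : Measurable[cylinderEvents S] freeze := by
    refine (@measurable_pi_iff _ _ _ (cylinderEvents S) _ freeze).2 fun i => ?_
    by_cases hi : i ∈ S
    · simpa only [freeze, if_pos hi] using measurable_cylinderEvent_apply hi
    · simpa only [freeze, if_neg hi] using @measurable_const _ _ _ (cylinderEvents S) (ω₀ i)
  have h_preimage : freeze ⁻¹' B = B :=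
    Set.ext fun ω => h _ _ fun i hi => if_pos hi
  rw [← h_preimage]
  exact h_freeze hB

end CylinderEvents

namespace LLLInstance

variable {I : LLLInstance.{u, v}}

instance : IsProbabilityMeasure I.tableLaw :=
  inferInstanceAs (IsProbabilityMeasure (Measure.infinitePi _))

theorem measurableSet_cylinderEvents_current_mem (l : List I.J) (j : I.J) :
    MeasurableSet[cylinderEvents {p | p.1 ∈ I.vbl j ∧ p.2 = I.resampleCount l p.1}]
      {R | I.current R l ∈ I.event j} := by
  have h_event : MeasurableSet[cylinderEvents (I.vbl j : Set (Fin I.n))] (I.event j) :=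
    measurableSet_cylinderEvents (I.meas j) (I.determinedBy_vblSet (I.event j))
  have h_current : Measurable[cylinderEvents {p | p.1 ∈ I.vbl j ∧ p.2 = I.resampleCount l p.1},
      cylinderEvents (I.vbl j : Set (Fin I.n))] fun R : I.Table => I.current R l := by
    rw [measurable_cylinderEvents_iff]
    intro i hi
    exact measurable_cylinderEvent_apply (i := (i, I.resampleCount l i)) ⟨hi, rfl⟩
  exact h_current h_event

theorem measurableSet_cylinderEvents_consistent (l : List I.J) :
    MeasurableSet[cylinderEvents {p | p.2 < I.resampleCount l p.1}] {R | I.Consistent R l} := by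
  induction l with
  | nil => exact MeasurableSet.univ
  | cons j l ih =>
    refine MeasurableSet.inter
      (cylinderEvents_mono ?_ _ (measurableSet_cylinderEvents_current_mem l j))
      (cylinderEvents_mono ?_ _ ih)
    · rintro p ⟨hi, hk⟩
      rw [Set.mem_ofPred_eq, resampleCount_cons, if_pos hi, hk]
      exact Nat.lt_succ_self _
    · intro p hp
      rw [Set.mem_ofPred_eq, resampleCount_cons]
      exact Nat.lt_add_right _ hp

theorem measurableSet_consistent (l : List I.J) : MeasurableSet {R | I.Consistent R l} :=
  cylinderEvents_le_pi _ (measurableSet_cylinderEvents_consistent l)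

theorem map_current (l : List I.J) :
    I.tableLaw.map (fun R => I.current R l) = Measure.pi I.μ := by
  rw [← Measure.infinitePi_eq_pi]
  exact Measure.map_infinitePi_infinitePi_of_inj (P := fun p : Fin I.n × ℕ => I.μ p.1)
    (f := fun i => (i, I.resampleCount l i)) fun i j h => congrArg Prod.fst h

/-- Every resampling in `l` uses samples that the earlier ones have not seen, so that the events
are independent. -/
theorem tableLaw_consistent (l : List I.J) :
    I.tableLaw {R | I.Consistent R l} = (l.map fun j => Measure.pi I.μ (I.event j)).prod := by
  induction l with
  | nil => simp [Consistent]
  | cons j l ih =>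
    have h_disj : Disjoint {p : Fin I.n × ℕ | p.1 ∈ I.vbl j ∧ p.2 = I.resampleCount l p.1}
        {p | p.2 < I.resampleCount l p.1} :=
      Set.disjoint_left.2 fun _ hp hp' => hp'.ne hp.2
    have h_current : Measurable fun R : I.Table => I.current R l :=
      measurable_pi_iff.2 fun i => measurable_pi_apply _
    calc I.tableLaw {R | I.Consistent R (j :: l)}
        = I.tableLaw ({R | I.current R l ∈ I.event j} ∩ {R | I.Consistent R l}) := rfl
      _ = I.tableLaw {R | I.current R l ∈ I.event j} * I.tableLaw {R | I.Consistent R l} :=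
          (ProbabilityTheory.Indep_iff _ _ _).1 (indep_cylinderEvents _ h_disj) _ _
            (measurableSet_cylinderEvents_current_mem l j)
            (measurableSet_cylinderEvents_consistent l)
      _ = Measure.pi I.μ (I.event j) * (l.map fun j => Measure.pi I.μ (I.event j)).prod := by
          rw [ih, ← map_current l, Measure.map_apply h_current (I.meas j)]
          rfl
      _ = ((j :: l).map fun j => Measure.pi I.μ (I.event j)).prod := by
          rw [List.map_cons, List.prod_cons]

end LLLInstance

theorem exists_cons_suffix_countP_eq {α : Type*} (p : α → Bool) {l : List α} {k : ℕ} (hk : 1 ≤ k)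
    (h : k ≤ l.countP p) : ∃ a m, (a :: m) <:+ l ∧ p a ∧ (a :: m).countP p = k := by
  induction l with
  | nil =>
    rw [List.countP_nil] at h
    omega
  | cons b l ih =>
    by_cases hkl : k ≤ l.countP p
    · obtain ⟨a, m, h_suffix, hm⟩ := ih hkl
      exact ⟨a, m, h_suffix.trans (List.suffix_cons b l), hm⟩
    · have hb : p b := by
        by_contra hb
        rw [List.countP_cons_of_neg hb] at h
        exact hkl h
      refine ⟨b, l, List.suffix_rfl, hb, ?_⟩
      rw [List.countP_cons_of_pos hb] at h ⊢
      omega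

namespace LLLInstance

variable {I : LLLInstance.{u, v}}

/-- The number of layered histories of `a` that are consistent with the random source. -/
noncomputable def historyCount (I : LLLInstance.{u, v}) (a : I.J) (R : I.Table) : ℝ≥0∞ :=
  ∑' τ : tails I.Dep I.core a, {R | I.Consistent R (layerWord ({a} :: τ.1))}.indicator 1 R

open Classical in
/-- The resamplings of `a` have different histories, as these contain `a` different numbers of
times. -/
theorem count_le_historyCount {R : I.Table} {l : List I.J} (hl : I.IsLog R l) (a : I.J) :
    (l.count a : ℝ≥0∞) ≤ I.historyCount a R := by
  have h_history : ∀ k : Fin (l.count a), ∃ τ : tails I.Dep I.core a,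
      I.Consistent R (layerWord ({a} :: τ.1)) ∧ (layerWord ({a} :: τ.1)).count a = k + 1 := by
    intro k
    obtain ⟨b, m, ⟨d, rfl⟩, hb, hm⟩ :=
      exists_cons_suffix_countP_eq (· == a) (Nat.le_add_left 1 k) (Nat.succ_le_of_lt k.2)
    obtain rfl : b = a := beq_iff_eq.1 hb
    cases hl.of_append with
    | cons _ _ hl' _ holds =>
      obtain ⟨τ, hτ, h_cons, h_count, -⟩ := exists_tail_of_isLog hl' holds
      exact ⟨⟨τ, hτ⟩, h_cons, h_count.trans hm⟩
  choose f hf h_count using h_history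
  have h_inj : Function.Injective f := fun k k' h => by
    have := h_count k
    rw [h, h_count k'] at this
    exact Fin.ext (by omega)
  calc (l.count a : ℝ≥0∞)
      = ∑' _ : Fin (l.count a), 1 := by simp
    _ = ∑' k : Fin (l.count a), {R | I.Consistent R (layerWord ({a} :: (f k).1))}.indicator 1 R :=
        tsum_congr fun k => (Set.indicator_of_mem (a := R) (Set.mem_ofPred.2 (hf k)) 1).symm
    _ ≤ I.historyCount a R := ENNReal.tsum_comp_le_tsum_of_injective h_inj
      fun τ : tails I.Dep I.core a => {R | I.Consistent R (layerWord ({a} :: τ.1))}.indicator 1 R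

theorem resamplings_eq_iSup (R : I.Table) :
    (I.resamplings R : ℝ≥0∞) = ⨆ l : {l : List I.J // I.IsLog R l}, (l.1.length : ℝ≥0∞) := by
  rw [resamplings, ENat.toENNReal_iSup]
  simp only [ENat.toENNReal_coe]

theorem resamplings_le_sum_historyCount (R : I.Table) :
    (I.resamplings R : ℝ≥0∞) ≤ ∑ a ∈ I.core, I.historyCount a R := by
  classical
  rw [resamplings_eq_iSup]
  refine iSup_le fun l => ?_
  have h_length : l.1.length = ∑ a ∈ I.core, l.1.count a := by
    simpa using (Multiset.sum_count_eq_card (s := I.core) (m := (l.1 : Multiset I.J))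
      (isLog_iff.1 l.2).2).symm
  rw [h_length, Nat.cast_sum]
  exact Finset.sum_le_sum fun a _ => count_le_historyCount l.2 a

theorem measurable_resamplings : Measurable fun R => (I.resamplings R : ℝ≥0∞) := by
  classical
  have : Countable {l : List I.J // ∀ j ∈ l, j ∈ I.core} := Subtype.countable
  have h_eq (R : I.Table) : (I.resamplings R : ℝ≥0∞) =
      ⨆ l : {l : List I.J // ∀ j ∈ l, j ∈ I.core},
        {R | I.Consistent R l.1}.indicator (fun _ => (l.1.length : ℝ≥0∞)) R := by
    simp only [resamplings_eq_iSup, iSup_subtype, isLog_iff, Set.indicator_apply,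
      Set.mem_ofPred_eq]
    refine iSup_congr fun l => ?_
    by_cases h_cons : I.Consistent R l <;> simp [h_cons]
  simp only [h_eq]
  exact .iSup fun l => measurable_const.indicator (measurableSet_consistent l.1)

theorem lintegral_historyCount (a : I.J) :
    ∫⁻ R, I.historyCount a R ∂I.tableLaw =
      ∑' τ : tails I.Dep I.core a,
        ((layerWord ({a} :: τ.1)).map fun j => Measure.pi I.μ (I.event j)).prod := by
  have : Countable (tails I.Dep I.core a) := Subtype.countable
  unfold historyCount
  rw [lintegral_tsum fun τ =>
    (measurable_one.indicator (measurableSet_consistent _)).aemeasurable]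
  refine tsum_congr fun τ => ?_
  rw [lintegral_indicator_one (measurableSet_consistent _), tableLaw_consistent]

/-- The hypothesis of the local lemma for the core, with slack factor `c`, in the variables
`y = x / (1 - x)`. -/
def LocalCondition (I : LLLInstance.{u, v}) (c : ℝ≥0∞) (y : I.J → ℝ≥0∞) : Prop :=
  ∀ b ∈ I.core, Measure.pi I.μ (I.event b) * ∏ d ∈ depNbr I.Dep I.core {b}, (1 + y d) ≤ c * y b

variable {c : ℝ≥0∞} {y : I.J → ℝ≥0∞}

theorem LocalCondition.tsum_tails_le (h : I.LocalCondition 1 y) (a : I.J) :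
    ∑' τ : tails I.Dep I.core a,
        ((layerWord ({a} :: τ.1)).map fun j => Measure.pi I.μ (I.event j)).prod ≤
      Measure.pi I.μ (I.event a) * ∏ d ∈ depNbr I.Dep I.core {a}, (1 + y d) :=
  _root_.tsum_tails_le (fun b hb => by simpa only [one_mul] using h b hb) a

theorem LocalCondition.lintegral_resamplings_le (h : I.LocalCondition 1 y) :
    ∫⁻ R, (I.resamplings R : ℝ≥0∞) ∂I.tableLaw ≤ ∑ a ∈ I.core, y a := by
  have h_meas (a : I.J) : Measurable (I.historyCount a) :=
    have : Countable (tails I.Dep I.core a) := Subtype.countable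
    .tsum fun τ => measurable_one.indicator (measurableSet_consistent _)
  calc ∫⁻ R, (I.resamplings R : ℝ≥0∞) ∂I.tableLaw
      ≤ ∫⁻ R, ∑ a ∈ I.core, I.historyCount a R ∂I.tableLaw :=
        lintegral_mono resamplings_le_sum_historyCount
    _ = ∑ a ∈ I.core, ∫⁻ R, I.historyCount a R ∂I.tableLaw :=
        lintegral_finsetSum _ fun a _ => h_meas a
    _ ≤ ∑ a ∈ I.core, y a := Finset.sum_le_sum fun a ha => by
        rw [lintegral_historyCount]
        exact (h.tsum_tails_le a).trans ((h a ha).trans_eq (one_mul _))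

theorem LocalCondition.tableLaw_exists_isLog_le (h : I.LocalCondition 1 y) (a : I.J) :
    I.tableLaw {R | ∃ l, I.IsLog R l ∧ I.current R l ∈ I.event a} ≤
      Measure.pi I.μ (I.event a) * ∏ d ∈ depNbr I.Dep I.core {a}, (1 + y d) := by
  have : Countable (tails I.Dep I.core a) := Subtype.countable
  have h_cover : {R | ∃ l, I.IsLog R l ∧ I.current R l ∈ I.event a} ⊆
      ⋃ τ : tails I.Dep I.core a, {R | I.Consistent R (layerWord ({a} :: τ.1))} := by
    rintro R ⟨l, hl, hR⟩
    obtain ⟨τ, hτ, h_cons, -⟩ := exists_tail_of_isLog hl hR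
    exact Set.mem_iUnion.2 ⟨⟨τ, hτ⟩, h_cons⟩
  refine (measure_mono h_cover).trans ((measure_iUnion_le _).trans ?_)
  simp only [tableLaw_consistent]
  exact h.tsum_tails_le a

/-- A variable that is resampled `s` times forces a history with at least `s` events, each of which
contributes a factor `c`. -/
theorem LocalCondition.tableLaw_le_resampleCount_le (hc₀ : c ≠ 0) (hc₁ : c ≤ 1)
    (h : I.LocalCondition c y) {s : ℕ} (hs : 1 ≤ s) :
    I.tableLaw {R | ∃ l i, I.IsLog R l ∧ s ≤ I.resampleCount l i} ≤
      c ^ s * ∑ a ∈ I.core, y a := by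
  have (a : I.J) : Countable (tails I.Dep I.core a) := Subtype.countable
  have h_cover : {R | ∃ l i, I.IsLog R l ∧ s ≤ I.resampleCount l i} ⊆
      ⋃ a ∈ I.core, ⋃ τ : {τ : tails I.Dep I.core a // s ≤ (layerWord ({a} :: τ.1)).length},
        {R | I.Consistent R (layerWord ({a} :: τ.1.1))} := by
    rintro R ⟨l, i, hl, hs'⟩
    obtain ⟨a, m, ⟨d, rfl⟩, hi, hm⟩ := exists_cons_suffix_countP_eq _ hs hs'
    cases hl.of_append with
    | cons _ _ hl' ha holds =>
      obtain ⟨τ, hτ, h_cons, -, h_length⟩ := exists_tail_of_isLog hl' holds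
      have hs_le : s ≤ (layerWord ({a} :: τ)).length :=
        hm.symm.le.trans (h_length i (of_decide_eq_true hi))
      exact Set.mem_iUnion₂.2 ⟨a, ha, Set.mem_iUnion.2 ⟨⟨⟨τ, hτ⟩, hs_le⟩, h_cons⟩⟩
  rw [Finset.mul_sum]
  refine (measure_mono h_cover).trans ((measure_biUnion_finset_le _ _).trans ?_)
  refine Finset.sum_le_sum fun a ha => (measure_iUnion_le _).trans ?_
  simp only [tableLaw_consistent]
  exact tsum_long_tails_le hc₀ hc₁ h ha s

end LLLInstance

/-- The odds `t / (1 - t)` of a probability `t`, through which the weights of the local lemma enter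
the sums over histories. -/
noncomputable def odds (t : ℝ) : ℝ≥0∞ := ENNReal.ofReal (t / (1 - t))

theorem one_add_odds {t : ℝ} (ht₀ : 0 ≤ t) (ht₁ : t < 1) :
    1 + odds t = (ENNReal.ofReal (1 - t))⁻¹ := by
  have h_pos : 0 < 1 - t := sub_pos.2 ht₁
  rw [odds, ← ENNReal.ofReal_one, ← ENNReal.ofReal_add zero_le_one (div_nonneg ht₀ h_pos.le),
    ← ENNReal.ofReal_inv_of_pos h_pos]
  congr 1
  field_simp
  ring

theorem ofReal_mul_prod_one_add_odds_le {ι : Type*} {x : ι → ℝ} {s : Finset ι} {p r : ℝ}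
    (hx : ∀ k ∈ s, 0 ≤ x k ∧ x k < 1) (h : p ≤ r * ∏ k ∈ s, (1 - x k)) :
    ENNReal.ofReal p * ∏ k ∈ s, (1 + odds (x k)) ≤ ENNReal.ofReal r := by
  have h_pos : 0 < ∏ k ∈ s, (1 - x k) := Finset.prod_pos fun k hk => sub_pos.2 (hx k hk).2
  have h_prod : ∏ k ∈ s, (1 + odds (x k)) = ENNReal.ofReal (∏ k ∈ s, (1 - x k))⁻¹ := by
    rw [← Finset.prod_inv_distrib, ENNReal.ofReal_prod_of_nonneg
      fun k hk => inv_nonneg.2 (sub_nonneg.2 (hx k hk).2.le)]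
    refine Finset.prod_congr rfl fun k hk => ?_
    rw [one_add_odds (hx k hk).1 (hx k hk).2, ENNReal.ofReal_inv_of_pos (sub_pos.2 (hx k hk).2)]
  rw [h_prod, ← ENNReal.ofReal_mul' (inv_nonneg.2 h_pos.le), ← div_eq_mul_inv]
  exact ENNReal.ofReal_le_ofReal ((div_le_iff₀ h_pos).2 h)

namespace LLLInstance

variable {I : LLLInstance.{u, v}} {x : I.J → ℝ}

theorem depNbr_singleton_of_notMem {b : I.J} (hb : b ∉ I.core) :
    depNbr I.Dep I.core {b} = I.coreNbr b := by
  ext c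
  simp only [mem_depNbr, coreNbr, Finset.mem_filter, Finset.mem_singleton, exists_eq_left, Dep]
  refine and_congr_right fun hc => ?_
  have : c ≠ b := ne_of_mem_of_not_mem hc hb
  tauto

open Classical in
theorem depNbr_singleton_of_mem {b : I.J} (hb : b ∈ I.core) :
    depNbr I.Dep I.core {b} = insert b (I.coreNbr b) := by
  ext c
  simp only [mem_depNbr, coreNbr, Finset.mem_filter, Finset.mem_singleton, exists_eq_left, Dep,
    Finset.mem_insert]
  rcases eq_or_ne c b with rfl | h <;> tauto

theorem localCondition_odds {c : ℝ} (hc : 0 ≤ c) (hx : ∀ j, 0 < x j ∧ x j < 1)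
    (h : ∀ j ∈ I.core, I.probOf j ≤ c * x j * ∏ k ∈ I.coreNbr j, (1 - x k)) :
    I.LocalCondition (ENNReal.ofReal c) fun j => odds (x j) := by
  classical
  intro b hb
  have h_notMem : b ∉ I.coreNbr b := by simp [coreNbr]
  rw [depNbr_singleton_of_mem hb, ← ofReal_measureReal]
  change _ ≤ ENNReal.ofReal c * ENNReal.ofReal (x b / (1 - x b))
  rw [← ENNReal.ofReal_mul hc, ← mul_div_assoc]
  refine ofReal_mul_prod_one_add_odds_le (fun k _ => ⟨(hx k).1.le, (hx k).2⟩) ?_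
  rw [Finset.prod_insert h_notMem, ← mul_assoc, div_mul_cancel₀ _ (sub_pos.2 (hx b).2).ne']
  exact h b hb

theorem localCondition_one (hx : ∀ j, 0 < x j ∧ x j < 1)
    (h : ∀ j ∈ I.core, I.probOf j ≤ x j * ∏ k ∈ I.coreNbr j, (1 - x k)) :
    I.LocalCondition 1 fun j => odds (x j) := by
  simpa only [ENNReal.ofReal_one] using
    localCondition_odds zero_le_one hx (by simpa only [one_mul] using h)

theorem sum_odds_le (hx : ∀ j, 0 < x j ∧ x j < 1) :
    ∑ j ∈ I.core, odds (x j) ≤ ENNReal.ofReal (I.v₁ x) := by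
  have h_odds (j : I.J) : 0 ≤ x j / (1 - x j) := div_nonneg (hx j).1.le (sub_pos.2 (hx j).2).le
  unfold odds
  rw [← ENNReal.ofReal_sum_of_nonneg fun j _ => h_odds j, v₁, T, Finset.sum_mul]
  refine ENNReal.ofReal_le_ofReal (Finset.sum_le_sum fun j hj => ?_)
  rw [div_eq_mul_one_div]
  exact mul_le_mul_of_nonneg_left (le_ciSup (f := fun j : I.core => 1 / (1 - x j))
    (Set.finite_range _).bddAbove ⟨j, hj⟩) (hx j).1.le

theorem LocalCondition.ae_resamplings_lt_top (h : I.LocalCondition 1 fun j => odds (x j)) :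
    ∀ᵐ R ∂I.tableLaw, I.resamplings R < ⊤ := by
  have h_sum : ∑ j ∈ I.core, odds (x j) < ⊤ :=
    ENNReal.sum_lt_top.2 fun _ _ => ENNReal.ofReal_lt_top
  filter_upwards [ae_lt_top measurable_resamplings
    (h.lintegral_resamplings_le.trans_lt h_sum).ne] with R hR
  exact ENat.toENNReal_lt_top.1 hR

theorem tableLaw_exists_isLog_notMem_core_le (hx : ∀ j, 0 < x j ∧ x j < 1)
    (h : ∀ j, I.probOf j ≤ x j * ∏ k ∈ I.coreNbr j, (1 - x k)) {a : I.J} (ha : a ∉ I.core) :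
    I.tableLaw {R | ∃ l, I.IsLog R l ∧ I.current R l ∈ I.event a} ≤ ENNReal.ofReal (x a) := by
  refine ((localCondition_one hx fun j _ => h j).tableLaw_exists_isLog_le a).trans ?_
  rw [depNbr_singleton_of_notMem ha, ← ofReal_measureReal]
  exact ofReal_mul_prod_one_add_odds_le (fun k _ => ⟨(hx k).1.le, (hx k).2⟩) (h a)

end LLLInstance

section ProbabilityBounds

variable {α : Type*} [MeasurableSpace α] {μ : Measure α} [IsProbabilityMeasure μ]

theorem one_sub_le_measureReal_of_compl {s : Set α} {b : ℝ} (hb : 0 ≤ b)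
    (h : μ sᶜ ≤ ENNReal.ofReal b) : 1 - b ≤ μ.real s := by
  have h_union : 1 ≤ μ.real s + μ.real sᶜ := by
    rw [← probReal_univ (μ := μ), ← Set.union_compl_self s]
    exact measureReal_union_le s sᶜ
  have h_compl : μ.real sᶜ ≤ b := ENNReal.toReal_le_of_le_ofReal hb h
  linarith

theorem one_sub_one_div_le_measureReal {f : α → ℝ≥0∞} (hf : Measurable f)
    {V : ℝ} (hV : 0 ≤ V) (h : ∫⁻ a, f a ∂μ ≤ ENNReal.ofReal V) {r : ℝ} (hr : 0 < r) :
    1 - 1 / r ≤ μ.real {a | f a ≤ ENNReal.ofReal (r * V)} := by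
  refine one_sub_le_measureReal_of_compl (one_div_nonneg.2 hr.le) ?_
  rcases hV.eq_or_lt with rfl | hV
  · have h_zero : f =ᵐ[μ] 0 := (lintegral_eq_zero_iff hf).1 (le_antisymm (by simpa using h) bot_le)
    have h_null : μ {a | f a ≤ ENNReal.ofReal (r * 0)}ᶜ = 0 := by
      rw [← mem_ae_iff]
      filter_upwards [h_zero] with a ha
      simp [ha]
    exact h_null.trans_le bot_le
  · calc μ {a | f a ≤ ENNReal.ofReal (r * V)}ᶜ
        ≤ μ {a | ENNReal.ofReal (r * V) ≤ f a} := by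
          refine measure_mono fun a ha => ?_
          rw [Set.mem_compl_iff, Set.mem_ofPred_eq, not_le] at ha
          exact ha.le
      _ ≤ (∫⁻ a, f a ∂μ) / ENNReal.ofReal (r * V) := meas_ge_le_lintegral_div hf.aemeasurable
          (ENNReal.ofReal_pos.2 (mul_pos hr hV)).ne' ENNReal.ofReal_ne_top
      _ ≤ ENNReal.ofReal V / ENNReal.ofReal (r * V) := by gcongr
      _ = ENNReal.ofReal (1 / r) := by
          rw [← ENNReal.ofReal_div_of_pos (mul_pos hr hV)]
          congr 1
          field_simp

theorem le_mul_one_add_tsum_indicator {M : ℝ} (hM : 0 < M) (t : ℝ≥0∞) :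
    t ≤ ENNReal.ofReal M *
      (1 + ∑' k : ℕ, (Set.Ioi (ENNReal.ofReal ((k + 1) * M))).indicator 1 t) := by
  rcases eq_or_ne t ⊤ with rfl | ht
  · simp [ENNReal.mul_top, hM]
  lift t to NNReal using ht
  set m := ⌈(t : ℝ) / M⌉₊ - 1
  have h_lt : ∀ k ∈ Finset.range m, (t : ℝ≥0∞) ∈ Set.Ioi (ENNReal.ofReal ((k + 1) * M)) := by
    intro k hk
    have h_ceil : ((k + 1 : ℕ) : ℝ) < t / M := Nat.lt_ceil.1 (by grind)
    rw [Set.mem_Ioi, ← ENNReal.ofReal_coe_nnreal, ENNReal.ofReal_lt_ofReal_iff_of_nonneg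
      (by positivity), ← lt_div_iff₀ hM]
    exact_mod_cast h_ceil
  calc (t : ℝ≥0∞) ≤ ENNReal.ofReal (M * (1 + m)) := by
        rw [← ENNReal.ofReal_coe_nnreal]
        refine ENNReal.ofReal_le_ofReal ((div_le_iff₀' hM).1 ((Nat.le_ceil _).trans ?_))
        exact_mod_cast (by omega : ⌈(t : ℝ) / M⌉₊ ≤ 1 + m)
    _ = ENNReal.ofReal M * (1 + ∑ k ∈ Finset.range m, 1) := by
        rw [ENNReal.ofReal_mul hM.le, ENNReal.ofReal_add zero_le_one m.cast_nonneg]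
        simp
    _ ≤ _ := by
        gcongr
        refine le_trans (Finset.sum_le_sum fun k hk => ?_) (ENNReal.sum_le_tsum (Finset.range m))
        rw [Set.indicator_of_mem (h_lt k hk), Pi.one_apply]

theorem lintegral_le_two_mul_of_exp_tail_of_pos {f : α → ℝ≥0∞} (hf : Measurable f) {M : ℝ}
    (hM : 0 < M)
    (h : ∀ r : ℝ, 1 ≤ r → μ {a | ENNReal.ofReal (r * M) < f a} ≤ ENNReal.ofReal (Real.exp (-r))) :
    ∫⁻ a, f a ∂μ ≤ ENNReal.ofReal (2 * M) := by
  have h_exp (k : ℕ) : ENNReal.ofReal (Real.exp (-(k + 1))) ≤ 2⁻¹ ^ (k + 1) := by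
    have h_half : Real.exp (-1) ≤ 2⁻¹ := by
      linarith [Real.exp_neg_one_lt_half]
    rw [show -((k : ℝ) + 1) = (k + 1 : ℕ) * (-1) by push_cast; ring, Real.exp_nat_mul,
      ENNReal.ofReal_pow (Real.exp_nonneg _)]
    gcongr
    simpa [ENNReal.ofReal_inv_of_pos] using ENNReal.ofReal_le_ofReal h_half
  have h_meas (k : ℕ) : MeasurableSet {a | ENNReal.ofReal ((k + 1) * M) < f a} :=
    measurableSet_lt measurable_const hf
  calc ∫⁻ a, f a ∂μ
      ≤ ∫⁻ a, ENNReal.ofReal M *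
          (1 + ∑' k : ℕ, {a | ENNReal.ofReal ((k + 1) * M) < f a}.indicator 1 a) ∂μ :=
        lintegral_mono fun a => le_mul_one_add_tsum_indicator hM (f a)
    _ = ENNReal.ofReal M * (μ Set.univ + ∑' k : ℕ, μ {a | ENNReal.ofReal ((k + 1) * M) < f a}) := by
        have h_ind (k : ℕ) := measurable_one (α := ℝ≥0∞).indicator (h_meas k)
        rw [lintegral_const_mul _ (by fun_prop), lintegral_add_left measurable_const,
          lintegral_tsum fun k => (h_ind k).aemeasurable, lintegral_one]
        simp only [lintegral_indicator_one (h_meas _)]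
    _ ≤ ENNReal.ofReal M * (1 + ∑' k : ℕ, 2⁻¹ ^ (k + 1)) := by
        gcongr with k
        · exact prob_le_one
        · exact (h (k + 1) (by simp)).trans (h_exp k)
    _ = ENNReal.ofReal (2 * M) := by
        rw [ENNReal.tsum_geometric_add_one, ENNReal.one_sub_inv_two, inv_inv,
          ENNReal.inv_mul_cancel two_ne_zero ENNReal.ofNat_ne_top, ENNReal.ofReal_mul zero_le_two,
          mul_comm, one_add_one_eq_two, ENNReal.ofReal_ofNat]

theorem lintegral_le_two_mul_of_exp_tail {f : α → ℝ≥0∞}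
    (hf : Measurable f) {M : ℝ} (hM : 0 ≤ M)
    (h : ∀ r : ℝ, 1 ≤ r → μ {a | ENNReal.ofReal (r * M) < f a} ≤ ENNReal.ofReal (Real.exp (-r))) :
    ∫⁻ a, f a ∂μ ≤ ENNReal.ofReal (2 * M) := by
  refine ENNReal.le_of_forall_pos_le_add fun δ hδ _ => ?_
  have h_le : M ≤ M + δ / 2 := le_add_of_nonneg_right (by positivity)
  have h_tail (r : ℝ) (hr : 1 ≤ r) :
      μ {a | ENNReal.ofReal (r * (M + δ / 2)) < f a} ≤ ENNReal.ofReal (Real.exp (-r)) := by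
    refine (measure_mono fun a ha => ?_).trans (h r hr)
    exact lt_of_le_of_lt (by gcongr) (Set.mem_ofPred.1 ha)
  have h_bound := lintegral_le_two_mul_of_exp_tail_of_pos hf (by positivity) h_tail
  refine h_bound.trans_eq ?_
  rw [mul_add, mul_div_cancel₀ _ two_ne_zero, ENNReal.ofReal_add (by positivity) (by positivity),
    ENNReal.ofReal_coe_nnreal]

end ProbabilityBounds

section CliqueBound

theorem one_sub_le_two_rpow_neg {t : ℝ} (ht : 0 ≤ t) : 1 - t ≤ (2 : ℝ) ^ (-t) := by
  rw [Real.rpow_def_of_pos two_pos]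
  refine (Real.one_sub_le_exp_neg t).trans (Real.exp_le_exp.2 ?_)
  nlinarith [Real.log_two_lt_d9]

theorem mul_one_sub_le_two_rpow_neg {a b : ℝ} (hab : a ≤ b) (hb : b ≤ 1) :
    a * (1 - b) ≤ (2 : ℝ) ^ (-(a + b)) :=
  calc a * (1 - b) ≤ 1 / 4 := by nlinarith [sq_nonneg (b - 1 / 2)]
    _ = (2 : ℝ) ^ (-2 : ℝ) := by rw [Real.rpow_neg two_pos.le]; norm_num
    _ ≤ (2 : ℝ) ^ (-(a + b)) := Real.rpow_le_rpow_of_exponent_le one_le_two (by linarith)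

theorem prod_one_sub_le_two_rpow_neg_sum {ι : Type*} {x : ι → ℝ} {s : Finset ι}
    (hx : ∀ k ∈ s, 0 ≤ x k ∧ x k ≤ 1) : ∏ k ∈ s, (1 - x k) ≤ (2 : ℝ) ^ (-∑ k ∈ s, x k) := by
  rw [← Finset.sum_neg_distrib, Real.rpow_sum_of_pos two_pos]
  exact Finset.prod_le_prod (fun k hk => sub_nonneg.2 (hx k hk).2)
    fun k hk => one_sub_le_two_rpow_neg (hx k hk).1

theorem exists_mul_prod_erase_le_two_rpow_neg_sum {ι : Type*} [DecidableEq ι] {x : ι → ℝ}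
    {K : Finset ι} (hx : ∀ k ∈ K, 0 ≤ x k ∧ x k ≤ 1) (hK : K.Nontrivial) :
    ∃ a ∈ K, x a * ∏ k ∈ K.erase a, (1 - x k) ≤ (2 : ℝ) ^ (-∑ k ∈ K, x k) := by
  obtain ⟨a, ha, h_min⟩ := K.exists_min_image x hK.nonempty
  obtain ⟨b, hb⟩ := hK.erase_nonempty (a := a)
  have hbK : b ∈ K := Finset.mem_of_mem_erase hb
  have hx' : ∀ k ∈ (K.erase a).erase b, 0 ≤ x k ∧ x k ≤ 1 := fun k hk =>
    hx k (Finset.mem_of_mem_erase (Finset.mem_of_mem_erase hk))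
  refine ⟨a, ha, ?_⟩
  calc x a * ∏ k ∈ K.erase a, (1 - x k)
      = x a * (1 - x b) * ∏ k ∈ (K.erase a).erase b, (1 - x k) := by
        rw [← Finset.mul_prod_erase (K.erase a) _ hb, mul_assoc]
    _ ≤ (2 : ℝ) ^ (-(x a + x b)) * (2 : ℝ) ^ (-∑ k ∈ (K.erase a).erase b, x k) :=
        mul_le_mul (mul_one_sub_le_two_rpow_neg (h_min b hbK) (hx b hbK).2)
          (prod_one_sub_le_two_rpow_neg_sum hx')
          (Finset.prod_nonneg fun k hk => sub_nonneg.2 (hx' k hk).2) (by positivity)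
    _ = (2 : ℝ) ^ (-∑ k ∈ K, x k) := by
        rw [← Real.rpow_add two_pos, ← Finset.add_sum_erase K x ha,
          ← Finset.add_sum_erase (K.erase a) x hb]
        ring_nf

end CliqueBound

namespace LLLInstance

variable {I : LLLInstance.{u, v}} {x : I.J → ℝ}

theorem prod_one_sub_pos (hx : ∀ j, 0 < x j ∧ x j < 1) (s : Finset I.J) :
    0 < ∏ k ∈ s, (1 - x k) :=
  Finset.prod_pos fun k _ => sub_pos.2 (hx k).2

theorem prod_one_sub_le_one (hx : ∀ j, 0 < x j ∧ x j < 1) (s : Finset I.J) :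
    ∏ k ∈ s, (1 - x k) ≤ 1 :=
  Finset.prod_le_one (fun k _ => sub_nonneg.2 (hx k).2.le) fun k _ => sub_le_self 1 (hx k).1.le

theorem one_sub_sum_nonCore_le_tableLaw_successSet (hx : ∀ j, 0 < x j ∧ x j < 1)
    (h : ∀ j, I.probOf j ≤ x j * ∏ k ∈ I.coreNbr j, (1 - x k)) :
    1 - ∑ j ∈ I.nonCore, x j ≤ I.tableLaw.real I.successSet := by
  classical
  have h_notMem : ∀ {j}, j ∈ I.nonCore ↔ j ∉ I.core := by simp [nonCore]
  have h_sub : I.successSetᶜ ⊆ {R | I.resamplings R < ⊤}ᶜ ∪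
      ⋃ j ∈ I.nonCore, {R | ∃ l, I.IsLog R l ∧ I.current R l ∈ I.event j} := by
    intro R hR
    by_contra h_union
    simp only [Set.mem_union, Set.mem_compl_iff, Set.mem_iUnion, Set.mem_ofPred_eq, not_or,
      not_not, exists_prop, h_notMem] at h_union
    refine hR ⟨h_union.1, fun l hl j hj => ?_⟩
    by_cases hc : j ∈ I.core
    · exact hl.2 j hc hj
    · exact h_union.2 ⟨j, hc, l, hl.1, hj⟩
  refine one_sub_le_measureReal_of_compl (Finset.sum_nonneg fun j _ => (hx j).1.le) ?_
  calc I.tableLaw I.successSetᶜ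
      ≤ I.tableLaw {R | I.resamplings R < ⊤}ᶜ +
          ∑ j ∈ I.nonCore, I.tableLaw {R | ∃ l, I.IsLog R l ∧ I.current R l ∈ I.event j} :=
        (measure_mono h_sub).trans ((measure_union_le _ _).trans
          (add_le_add_right (measure_biUnion_finset_le _ _) _))
    _ ≤ 0 + ∑ j ∈ I.nonCore, ENNReal.ofReal (x j) := by
        gcongr with j hj
        · exact (mem_ae_iff.1 (LocalCondition.ae_resamplings_lt_top (localCondition_one hx
            fun j _ => h j))).le
        · exact tableLaw_exists_isLog_notMem_core_le hx h (h_notMem.1 hj)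
    _ = ENNReal.ofReal (∑ j ∈ I.nonCore, x j) := by
        rw [zero_add, ENNReal.ofReal_sum_of_nonneg fun j _ => (hx j).1.le]

theorem δ_pos (hx : ∀ j, 0 < x j ∧ x j < 1) (hI : I.core.Nonempty) : 0 < I.δ x := by
  have : Nonempty I.core := hI.to_subtype
  obtain ⟨j, hj⟩ := exists_eq_ciInf_of_finite
    (f := fun j : I.core => x j * ∏ k ∈ I.coreNbr j, (1 - x k))
  rw [δ, ← hj]
  exact mul_pos (hx _).1 (prod_one_sub_pos hx _)

theorem δ_le {j : I.J} (hj : j ∈ I.core) : I.δ x ≤ x j * ∏ k ∈ I.coreNbr j, (1 - x k) :=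
  ciInf_le (f := fun j : I.core => x j * ∏ k ∈ I.coreNbr j, (1 - x k))
    (Set.finite_range _).bddBelow ⟨j, hj⟩

open Classical in
/-- The core events that depend on one variable are pairwise neighbours. -/
theorem sum_filter_mem_vbl_le (hx : ∀ j, 0 < x j ∧ x j < 1) (i : Fin I.n) :
    ∑ j ∈ I.core with i ∈ I.vbl j, x j ≤ max 1 (Real.logb 2 (1 / I.δ x)) := by
  set K := I.core.filter fun j => i ∈ I.vbl j with hK
  rcases K.eq_empty_or_nonempty with h_empty | h_nonempty
  · simp [h_empty]
  rcases h_nonempty.exists_eq_singleton_or_nontrivial with ⟨a, ha⟩ | h_nontrivial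
  · rw [ha, Finset.sum_singleton]
    exact le_max_of_le_left (hx a).2.le
  obtain ⟨a, ha, h_le⟩ := exists_mul_prod_erase_le_two_rpow_neg_sum
    (fun k _ => ⟨(hx k).1.le, (hx k).2.le⟩) h_nontrivial
  have ha' : a ∈ I.core ∧ i ∈ I.vbl a := Finset.mem_filter.1 ha
  have h_sub : K.erase a ⊆ I.coreNbr a := by
    intro c hc
    rw [Finset.mem_erase, hK, Finset.mem_filter] at hc
    exact Finset.mem_filter.2 ⟨hc.2.1, hc.1, i, Finset.mem_inter.2 ⟨hc.2.2, ha'.2⟩⟩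
  have h_prod : ∏ k ∈ I.coreNbr a, (1 - x k) ≤ ∏ k ∈ K.erase a, (1 - x k) := by
    rw [← Finset.prod_sdiff h_sub]
    exact mul_le_of_le_one_left (prod_one_sub_pos hx _).le (prod_one_sub_le_one hx _)
  have h_δ : I.δ x ≤ (2 : ℝ) ^ (-∑ k ∈ K, x k) :=
    (δ_le ha'.1).trans ((mul_le_mul_of_nonneg_left h_prod (hx a).1.le).trans h_le)
  have h_pos : 0 < I.δ x := δ_pos hx ⟨a, ha'.1⟩
  refine le_max_of_le_right ?_
  rw [Real.le_logb_iff_rpow_le one_lt_two (one_div_pos.2 h_pos), one_div]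
  rw [Real.rpow_neg zero_le_two] at h_δ
  exact (le_inv_comm₀ h_pos (by positivity)).1 h_δ

theorem T_le (hx : ∀ j, 0 < x j ∧ x j < 1) (h_vbl : ∀ j ∈ I.core, (I.vbl j).Nonempty) :
    I.T x ≤ I.n * max 1 (Real.logb 2 (1 / I.δ x)) := by
  classical
  calc I.T x ≤ ∑ j ∈ I.core, ∑ i, if i ∈ I.vbl j then x j else 0 := by
        refine Finset.sum_le_sum fun j hj => ?_
        rw [Finset.sum_ite_mem, Finset.univ_inter, Finset.sum_const, nsmul_eq_mul]
        exact le_mul_of_one_le_left (hx j).1.le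
          (Nat.one_le_cast.2 (Finset.card_pos.2 (h_vbl j hj)))
    _ = ∑ i, ∑ j ∈ I.core with i ∈ I.vbl j, x j := by
        simp only [Finset.sum_filter]
        exact Finset.sum_comm
    _ ≤ ∑ _i : Fin I.n, max 1 (Real.logb 2 (1 / I.δ x)) :=
        Finset.sum_le_sum fun i _ => sum_filter_mem_vbl_le hx i
    _ = I.n * max 1 (Real.logb 2 (1 / I.δ x)) := by simp

theorem v₁_nonneg (hx : ∀ j, 0 < x j ∧ x j < 1) : 0 ≤ I.v₁ x :=
  mul_nonneg (Finset.sum_nonneg fun j _ => (hx j).1.le)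
    (Real.iSup_nonneg fun j => one_div_nonneg.2 (sub_nonneg.2 (hx j).2.le))

theorem lintegral_resamplings_le_v₁ (hx : ∀ j, 0 < x j ∧ x j < 1)
    (h : ∀ j ∈ I.core, I.probOf j ≤ x j * ∏ k ∈ I.coreNbr j, (1 - x k)) :
    ∫⁻ R, (I.resamplings R : ℝ≥0∞) ∂I.tableLaw ≤ ENNReal.ofReal (I.v₁ x) :=
  (localCondition_one hx h).lintegral_resamplings_le.trans (sum_odds_le hx)

theorem one_sub_one_div_le_tableLaw_resamplings_le (hx : ∀ j, 0 < x j ∧ x j < 1)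
    (h : ∀ j ∈ I.core, I.probOf j ≤ x j * ∏ k ∈ I.coreNbr j, (1 - x k)) {r : ℝ} (hr : 0 < r) :
    1 - 1 / r ≤ I.tableLaw.real
      {R | (I.resamplings R : ℝ≥0∞) ≤ ENNReal.ofReal (r * I.v₁ x)} :=
  one_sub_one_div_le_measureReal measurable_resamplings (v₁_nonneg hx)
    (lintegral_resamplings_le_v₁ hx h) hr

theorem vbl_nonempty {j : I.J} {ω : I.Assignment} (hω : ω ∈ I.event j) (hj : I.probOf j < 1) :
    (I.vbl j).Nonempty := by
  by_contra h_empty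
  rw [Finset.not_nonempty_iff_eq_empty] at h_empty
  have h_det : I.DeterminedBy ∅ (I.event j) := h_empty ▸ I.determinedBy_vblSet (I.event j)
  have h_univ : I.event j = Set.univ :=
    Set.eq_univ_of_forall fun ω' => (h_det ω ω' (by simp)).1 hω
  simp [probOf, h_univ] at hj

theorem length_le_sum_resampleCount {R : I.Table} {l : List I.J} (hl : I.IsLog R l)
    (hp : ∀ j ∈ I.core, I.probOf j < 1) : l.length ≤ ∑ i, I.resampleCount l i := by
  induction hl with
  | nil => exact Nat.zero_le _
  | cons l j _ hj holds ih =>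
    have h_one : 1 ≤ ∑ i, if i ∈ I.vbl j then 1 else 0 := by
      simpa using (vbl_nonempty holds (hp j hj)).card_pos
    simp only [resampleCount_cons, Finset.sum_add_distrib, List.length_cons]
    omega

theorem exists_isLog_lt_resampleCount {R : I.Table} {t : ℝ} (ht : 0 ≤ t)
    (hp : ∀ j ∈ I.core, I.probOf j < 1)
    (h : ENNReal.ofReal (I.n * t) < (I.resamplings R : ℝ≥0∞)) :
    ∃ l i, I.IsLog R l ∧ ⌊t⌋₊ + 1 ≤ I.resampleCount l i := by
  rw [resamplings_eq_iSup, lt_iSup_iff] at h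
  obtain ⟨⟨l, hl⟩, h_length⟩ := h
  rw [← ENNReal.ofReal_natCast, ENNReal.ofReal_lt_ofReal_iff'] at h_length
  have h_sum : ∑ _i : Fin I.n, t < ∑ i, (I.resampleCount l i : ℝ) := by
    have h_le : (l.length : ℝ) ≤ ∑ i, (I.resampleCount l i : ℝ) := by
      exact_mod_cast length_le_sum_resampleCount hl hp
    simpa using h_length.1.trans_le h_le
  obtain ⟨i, -, hi⟩ := Finset.exists_lt_of_sum_lt h_sum
  exact ⟨l, i, hl, (Nat.floor_lt ht).2 hi⟩

end LLLInstance

section SlackEstimate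

variable {ε u r : ℝ}

theorem one_sub_half_pow_le_exp_neg (hε₀ : 0 < ε) (hε₁ : ε ≤ 1) {m : ℕ} (hm : 2 * r / ε ≤ m) :
    (1 - ε / 2) ^ m ≤ Real.exp (-r) := by
  have h_le : r ≤ m * (ε / 2) := by
    rw [div_le_iff₀ hε₀] at hm
    linarith
  calc (1 - ε / 2) ^ m ≤ Real.exp (-(ε / 2)) ^ m :=
        pow_le_pow_left₀ (by linarith) (Real.one_sub_le_exp_neg _) m
    _ = Real.exp (m * -(ε / 2)) := (Real.exp_nat_mul _ _).symm
    _ ≤ Real.exp (-r) := Real.exp_le_exp.2 (by linarith)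

theorem two_mul_le_exp_two_mul_logb (hu : 0 ≤ u) :
    2 * u ≤ Real.exp (2 * Real.logb 2 (2 + u)) := by
  have h_log : Real.log (2 + u) ≤ Real.logb 2 (2 + u) := by
    refine le_div_self (Real.log_nonneg (by linarith)) (Real.log_pos one_lt_two) ?_
    linarith [Real.log_two_lt_d9]
  calc 2 * u ≤ (2 + u) * (2 + u) := by nlinarith
    _ = Real.exp (2 * Real.log (2 + u)) := by
        rw [two_mul, Real.exp_add, Real.exp_log (by linarith)]
    _ ≤ Real.exp (2 * Real.logb 2 (2 + u)) := by gcongr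

theorem one_sub_half_pow_mul_le_exp_neg (hε₀ : 0 < ε) (hε₁ : ε ≤ 1) (hu : 0 ≤ u) (hr : 1 ≤ r)
    {m : ℕ} (hm : 6 * r * Real.logb 2 (2 + u) / ε ≤ m) :
    (1 - ε / 2) ^ m * (2 * u) ≤ Real.exp (-r) := by
  set L := Real.logb 2 (2 + u)
  have hL : 1 ≤ L := by
    rw [Real.le_logb_iff_rpow_le one_lt_two (by linarith), Real.rpow_one]
    linarith
  have hm' : 2 * (3 * r * L) / ε ≤ m := by
    rwa [show 2 * (3 * r * L) = 6 * r * L by ring]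
  calc (1 - ε / 2) ^ m * (2 * u) ≤ Real.exp (-(3 * r * L)) * Real.exp (2 * L) :=
        mul_le_mul (one_sub_half_pow_le_exp_neg hε₀ hε₁ hm') (two_mul_le_exp_two_mul_logb hu)
          (by positivity) (Real.exp_nonneg _)
    _ = Real.exp (-(3 * r * L) + 2 * L) := (Real.exp_add _ _).symm
    _ ≤ Real.exp (-r) := Real.exp_le_exp.2 (by nlinarith)

end SlackEstimate

namespace LLLInstance

variable {I : LLLInstance.{u, v}} {x : I.J → ℝ} {ε : ℝ}

theorem probOf_lt_one (hx : ∀ j, 0 < x j ∧ x j < 1) {j : I.J}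
    (h : I.probOf j ≤ x j * ∏ k ∈ I.coreNbr j, (1 - x k)) : I.probOf j < 1 :=
  h.trans_lt ((mul_le_of_le_one_right (hx j).1.le (prod_one_sub_le_one hx _)).trans_lt (hx j).2)

theorem probOf_le_of_slack (hx : ∀ j, 0 < x j ∧ x j < 1) (hε : 0 ≤ ε) {j : I.J}
    (h : I.probOf j ≤ (1 - ε) * x j * ∏ k ∈ I.coreNbr j, (1 - x k)) :
    I.probOf j ≤ x j * ∏ k ∈ I.coreNbr j, (1 - x k) := by
  refine h.trans (mul_le_mul_of_nonneg_right ?_ (prod_one_sub_pos hx _).le)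
  exact mul_le_of_le_one_left (hx j).1.le (sub_le_self 1 hε)

/-- Scaling `x` by `1 - ε / 2` spends half of the slack on keeping `x` away from `1`. -/
theorem localCondition_odds_scaled (hx : ∀ j, 0 < x j ∧ x j < 1) (hε₀ : 0 ≤ ε) (hε₁ : ε ≤ 1)
    (h : ∀ j ∈ I.core, I.probOf j ≤ (1 - ε) * x j * ∏ k ∈ I.coreNbr j, (1 - x k)) :
    I.LocalCondition (ENNReal.ofReal (1 - ε / 2)) fun j => odds ((1 - ε / 2) * x j) := by
  have hx' : ∀ j, 0 < (1 - ε / 2) * x j ∧ (1 - ε / 2) * x j < 1 := fun j =>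
    ⟨mul_pos (by linarith) (hx j).1, by nlinarith [hx j]⟩
  refine localCondition_odds (by linarith) hx' fun j hj => (h j hj).trans ?_
  refine mul_le_mul ?_ (Finset.prod_le_prod (fun k _ => sub_nonneg.2 (hx k).2.le) fun k _ => ?_)
    (prod_one_sub_pos hx _).le (mul_nonneg (by linarith) (hx' j).1.le)
  · nlinarith [(hx j).1, mul_nonneg (sq_nonneg ε) (hx j).1.le]
  · nlinarith [(hx k).1]

theorem sum_odds_scaled_le (hx : ∀ j, 0 < x j ∧ x j < 1) (hε₀ : 0 < ε) (hε₁ : ε ≤ 1) :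
    ∑ j ∈ I.core, odds ((1 - ε / 2) * x j) ≤ ENNReal.ofReal (2 * (I.T x / ε)) := by
  rw [T, Finset.sum_div, Finset.mul_sum, ENNReal.ofReal_sum_of_nonneg
    fun j _ => mul_nonneg zero_le_two (div_nonneg (hx j).1.le hε₀.le)]
  refine Finset.sum_le_sum fun j _ => ENNReal.ofReal_le_ofReal ?_
  have h_away : ε / 2 ≤ 1 - (1 - ε / 2) * x j := by nlinarith [hx j]
  calc (1 - ε / 2) * x j / (1 - (1 - ε / 2) * x j) ≤ x j / (ε / 2) :=
        div_le_div₀ (hx j).1.le (by nlinarith [(hx j).1]) (by linarith) h_away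
    _ = 2 * (x j / ε) := by field_simp

theorem T_div_nonneg (hx : ∀ j, 0 < x j ∧ x j < 1) (hε : 0 < ε) : 0 ≤ I.T x / ε :=
  div_nonneg (Finset.sum_nonneg fun j _ => (hx j).1.le) hε.le

theorem v₂_nonneg (hx : ∀ j, 0 < x j ∧ x j < 1) (hε : 0 < ε) : 0 ≤ I.v₂ x ε := by
  have h_T : 0 ≤ I.T x / ε := T_div_nonneg hx hε
  exact mul_nonneg (by positivity) (Real.logb_nonneg one_lt_two (by linarith))

theorem tableLaw_lt_resamplings_le (hx : ∀ j, 0 < x j ∧ x j < 1) (hε₀ : 0 < ε) (hε₁ : ε < 1)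
    (h : ∀ j ∈ I.core, I.probOf j ≤ (1 - ε) * x j * ∏ k ∈ I.coreNbr j, (1 - x k)) {r : ℝ}
    (hr : 1 ≤ r) :
    I.tableLaw {R | ENNReal.ofReal (r * (6 * I.v₂ x ε)) < (I.resamplings R : ℝ≥0∞)} ≤
      ENNReal.ofReal (Real.exp (-r)) := by
  have h_T : 0 ≤ I.T x / ε := T_div_nonneg hx hε₀
  have h_log : 0 ≤ Real.logb 2 (2 + I.T x / ε) := Real.logb_nonneg one_lt_two (by linarith)
  set t := 6 * r * Real.logb 2 (2 + I.T x / ε) / ε with ht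
  have h_v₂ : r * (6 * I.v₂ x ε) = I.n * t := by
    rw [v₂, ht]
    ring
  have h_sub : {R | ENNReal.ofReal (r * (6 * I.v₂ x ε)) < (I.resamplings R : ℝ≥0∞)} ⊆
      {R | ∃ l i, I.IsLog R l ∧ ⌊t⌋₊ + 1 ≤ I.resampleCount l i} := fun R hR =>
    exists_isLog_lt_resampleCount (by positivity)
      (fun j hj => probOf_lt_one hx (probOf_le_of_slack hx hε₀.le (h j hj)))
      (h_v₂ ▸ Set.mem_ofPred.1 hR)
  have h_half : 0 < 1 - ε / 2 := by linarith
  calc I.tableLaw {R | ENNReal.ofReal (r * (6 * I.v₂ x ε)) < (I.resamplings R : ℝ≥0∞)}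
      ≤ ENNReal.ofReal (1 - ε / 2) ^ (⌊t⌋₊ + 1) * ∑ j ∈ I.core, odds ((1 - ε / 2) * x j) :=
        (measure_mono h_sub).trans
          ((localCondition_odds_scaled hx hε₀.le hε₁.le h).tableLaw_le_resampleCount_le
            (ENNReal.ofReal_pos.2 h_half).ne' (ENNReal.ofReal_le_one.2 (by linarith)) (by omega))
    _ ≤ ENNReal.ofReal ((1 - ε / 2) ^ (⌊t⌋₊ + 1) * (2 * (I.T x / ε))) := by
        rw [ENNReal.ofReal_mul (by positivity), ENNReal.ofReal_pow h_half.le]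
        gcongr
        exact sum_odds_scaled_le hx hε₀ hε₁.le
    _ ≤ ENNReal.ofReal (Real.exp (-r)) := ENNReal.ofReal_le_ofReal
        (one_sub_half_pow_mul_le_exp_neg hε₀ hε₁.le h_T hr
          (by exact_mod_cast (Nat.lt_floor_add_one t).le))

theorem lintegral_resamplings_le_v₂ (hx : ∀ j, 0 < x j ∧ x j < 1) (hε₀ : 0 < ε) (hε₁ : ε < 1)
    (h : ∀ j ∈ I.core, I.probOf j ≤ (1 - ε) * x j * ∏ k ∈ I.coreNbr j, (1 - x k)) :
    ∫⁻ R, (I.resamplings R : ℝ≥0∞) ∂I.tableLaw ≤ ENNReal.ofReal (12 * I.v₂ x ε) := by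
  have h_nonneg : 0 ≤ 6 * I.v₂ x ε := mul_nonneg (by norm_num) (v₂_nonneg hx hε₀)
  rw [show 12 * I.v₂ x ε = 2 * (6 * I.v₂ x ε) by ring]
  exact lintegral_le_two_mul_of_exp_tail measurable_resamplings h_nonneg
    fun r hr => tableLaw_lt_resamplings_le hx hε₀ hε₁ h hr

theorem one_sub_exp_neg_le_tableLaw_resamplings_le (hx : ∀ j, 0 < x j ∧ x j < 1) (hε₀ : 0 < ε)
    (hε₁ : ε < 1) (h : ∀ j ∈ I.core, I.probOf j ≤ (1 - ε) * x j * ∏ k ∈ I.coreNbr j, (1 - x k))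
    {r : ℝ} (hr : 1 ≤ r) :
    1 - Real.exp (-r) ≤ I.tableLaw.real
      {R | (I.resamplings R : ℝ≥0∞) ≤ ENNReal.ofReal (r * (12 * I.v₂ x ε))} := by
  have h_nonneg : 0 ≤ I.v₂ x ε := v₂_nonneg hx hε₀
  refine one_sub_le_measureReal_of_compl (Real.exp_nonneg _)
    ((measure_mono fun R hR => ?_).trans (tableLaw_lt_resamplings_le hx hε₀ hε₁ h hr))
  rw [Set.mem_compl_iff, Set.mem_ofPred_eq, not_le] at hR
  refine lt_of_le_of_lt (ENNReal.ofReal_le_ofReal ?_) hR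
  gcongr
  norm_num

end LLLInstance

namespace LLLInstance

variable {I : LLLInstance.{u, v}} (R : I.Table) (l : List I.J) {i : Fin I.n} {j : I.J}

theorem current_cons_of_mem (hi : i ∈ I.vbl j) :
    I.current R (j :: l) i = R (i, I.resampleCount l i + 1) := by
  have e := resampleCount_cons j l i
  rw [if_pos hi] at e
  exact congrArg (β := I.Ω i) (fun k : ℕ => R (i, k)) e

theorem current_cons_of_notMem (hi : i ∉ I.vbl j) :
    I.current R (j :: l) i = I.current R l i := by
  have e := resampleCount_cons j l i
  rw [if_neg hi, add_zero] at e
  exact congrArg (β := I.Ω i) (fun k : ℕ => R (i, k)) e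

end LLLInstance

section Machine

variable {I : LLLInstance.{u, v}} {P : Presentation I} {R : I.Table}

namespace MState

variable (σ : MState I)

theorem setStk_stk_of_ne {s s' : ℕ} (L : List Bool) (h : s' ≠ s) :
    (σ.setStk s L).stk s' = σ.stk s' :=
  Function.update_of_ne h _ _

@[simp] theorem setStk_stk_self (s : ℕ) (L : List Bool) : (σ.setStk s L).stk s = L :=
  Function.update_self _ _ _

@[simp] theorem setStk_setStk_self (s : ℕ) (L L' : List Bool) :
    (σ.setStk s L).setStk s L' = σ.setStk s L' := by
  simp only [setStk, Function.update_idem]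

theorem setStk_comm {s s' : ℕ} (h : s ≠ s') (L L' : List Bool) :
    (σ.setStk s L).setStk s' L' = (σ.setStk s' L').setStk s L := by
  simp only [setStk, Function.update_comm h]

theorem setStk_eq_self {s : ℕ} {L : List Bool} (h : σ.stk s = L) : σ.setStk s L = σ := by
  rw [setStk, ← h, Function.update_eq_self]

theorem draw_stk (a : ℕ) : (σ.draw R a).stk = σ.stk := by
  unfold draw
  split_ifs <;> rfl

theorem draw_setStk (s : ℕ) (L : List Bool) (a : ℕ) :
    (σ.setStk s L).draw R a = (σ.draw R a).setStk s L := by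
  unfold draw
  split_ifs <;> rfl

theorem length_pushOpt_le (s' : ℕ) (b : Option Bool) (s : ℕ) :
    ((σ.pushOpt s' b).stk s).length ≤ (σ.stk s).length + 1 := by
  by_cases h : s = s'
  · subst h
    cases b <;> simp [pushOpt]
  · rw [pushOpt, setStk_stk_of_ne _ _ h]
    omega

/-- Draw a fresh sample of every variable in `S`. -/
def drawSet (R : I.Table) (S : Finset (Fin I.n)) (σ : MState I) : MState I where
  stk := σ.stk
  val i := if i ∈ S then R (i, σ.drawn i) else σ.val i
  drawn i := if i ∈ S then σ.drawn i + 1 else σ.drawn i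

theorem drawSet_empty : σ.drawSet R ∅ = σ := by
  simp [drawSet]

theorem drawSet_insert {S : Finset (Fin I.n)} {i : Fin I.n} (hi : i ∉ S) :
    σ.drawSet R (insert i S) = (σ.drawSet R S).draw R i := by
  simp only [draw, drawSet, i.isLt, ↓reduceDIte, Fin.eta, hi, ↓reduceIte, mk.injEq, true_and]
  constructor <;> funext k <;> by_cases hk : k = i
  · subst hk
    simpa using congrArg (β := I.Ω k) (fun m => R (k, m)) (if_neg hi).symm
  · simp [hk]
  · simp [hk, hi]
  · simp [hk]

theorem drawSet_vbl_val {l : List I.J} {j : I.J} (hval : σ.val = I.current R l)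
    (hdrawn : σ.drawn = fun i => I.resampleCount l i + 1) :
    (σ.drawSet R (I.vbl j)).val = I.current R (j :: l) := by
  obtain ⟨stk, val, drawn⟩ := σ
  obtain rfl : drawn = _ := hdrawn
  obtain rfl : val = _ := hval
  funext i
  simp only [drawSet]
  split_ifs with hi
  · exact (LLLInstance.current_cons_of_mem R l hi).symm
  · exact (LLLInstance.current_cons_of_notMem R l hi).symm

theorem drawSet_vbl_drawn {l : List I.J} {j : I.J}
    (hdrawn : σ.drawn = fun i => I.resampleCount l i + 1) :
    (σ.drawSet R (I.vbl j)).drawn = fun i => I.resampleCount (j :: l) i + 1 := by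
  funext i
  simp only [drawSet, hdrawn, LLLInstance.resampleCount_cons]
  split_ifs <;> rfl

end MState

namespace Prog

/-- A strict upper bound for the numbers of the stacks that the program may change. -/
def bound : Prog → ℕ
  | skip => 0
  | push s _ => s + 1
  | pop s => s + 1
  | readInput s _ => s + 1
  | readValue s _ _ => s + 1
  | isVar s _ => s + 1
  | sample _ => 0
  | seq p q => max p.bound q.bound
  | ite _ p q => max p.bound q.bound
  | .while _ p => p.bound

/-- Empty the stacks with numbers below `k`. -/
def clear : ℕ → Prog
  | 0 => .skip
  | k + 1 => .seq (clear k) (.while (.nonempty k) (.pop k))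

/-- Draw new samples of the variables in the set whose bit vector is on stack `1`. The stack `c`
counts the variables. -/
def resample (c : ℕ) : Prog :=
  .while (.nonempty 1)
    (.seq (.ite (.top 1) (.sample c) .skip) (.seq (.pop 1) (.push c true)))

/-- Write the bit vector of the set of all variables on stack `1`. The stack `c` counts the
variables. -/
def allVars (c : ℕ) : Prog :=
  .seq (.isVar 1 c) (.seq (.while (.top 1) (.seq (.push c true) (.isVar 1 c)))
    (.seq (.pop 1) (.while (.nonempty c) (.pop c))))

/-- Draw new samples of the variables in the set whose bit vector is on stack `1`, empty the stacks
and look for a core event that holds. -/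
def round (V : Prog) (c : ℕ) : Prog :=
  .seq (.resample c) (.seq (.clear (c + 1)) V)

/-- The modified Moser–Tardos algorithm, with `V` to find a core event that holds. -/
def moserTardos (V : Prog) (c : ℕ) : Prog :=
  .seq (.allVars c) (.seq (V.round c) (.while (.top 0) (V.round c)))

end Prog

theorem Runs.stk_eq {p : Prog} {σ σ' : MState I} {t : ℕ} (h : Runs P R p σ t σ') {s : ℕ}
    (hs : p.bound ≤ s) : σ'.stk s = σ.stk s := by
  induction h with
  | skip | whileFalse => rfl
  | push | pop | readInput | readValue | isVar =>
    simp only [Prog.bound] at hs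
    exact MState.setStk_stk_of_ne _ _ (by omega)
  | sample => rw [MState.draw_stk]
  | seq _ _ _ _ _ _ _ _ _ ihp ihq =>
    simp only [Prog.bound, max_le_iff] at hs
    rw [ihq hs.2, ihp hs.1]
  | iteTrue _ _ _ _ _ _ _ _ ih =>
    simp only [Prog.bound, max_le_iff] at hs
    exact ih hs.1
  | iteFalse _ _ _ _ _ _ _ _ ih =>
    simp only [Prog.bound, max_le_iff] at hs
    exact ih hs.2
  | whileTrue _ _ _ _ _ _ _ _ _ _ ihp ihw => rw [ihw hs, ihp hs]

theorem Runs.length_stk_le {p : Prog} {σ σ' : MState I} {t : ℕ} (h : Runs P R p σ t σ') (s : ℕ) :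
    (σ'.stk s).length ≤ (σ.stk s).length + t := by
  induction h with
  | skip | whileFalse => omega
  | push | readInput | readValue | isVar => exact MState.length_pushOpt_le _ _ _ _
  | pop s' σ =>
    by_cases h : s = s'
    · subst h
      simp only [MState.setStk_stk_self, List.length_tail]
      omega
    · rw [MState.setStk_stk_of_ne _ _ h]
      omega
  | sample => rw [MState.draw_stk]; omega
  | seq | iteTrue | iteFalse | whileTrue => omega

theorem Runs.while_step {c : StackTest} {p : Prog} {σ σ₁ σ₂ : MState I} {t t₁ t₂ : ℕ}
    (hc : c.eval σ = true) (hp : Runs P R p σ t₁ σ₁) (hw : Runs P R (.while c p) σ₁ t₂ σ₂)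
    (ht : t = 1 + t₁ + t₂) : Runs P R (.while c p) σ t σ₂ :=
  ht ▸ .whileTrue _ _ _ _ _ _ _ hc hp hw

theorem runs_popAll (s : ℕ) (L : List Bool) (σ : MState I) :
    Runs P R (.while (.nonempty s) (.pop s)) (σ.setStk s L) (2 * L.length + 1)
      (σ.setStk s []) := by
  induction L with
  | nil => exact .whileFalse _ _ _ (by simp [StackTest.eval])
  | cons b L ih =>
    have hpop : Runs P R (.pop s) (σ.setStk s (b :: L)) 1 (σ.setStk s L) := by
      simpa using Runs.pop s (σ.setStk s (b :: L))
    exact .while_step (by simp [StackTest.eval]) hpop ih (by rw [List.length_cons]; ring)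

theorem runs_clear (k : ℕ) (σ : MState I) {H : ℕ} (hH : ∀ s < k, (σ.stk s).length ≤ H) :
    ∃ t ≤ k * (2 * H + 1) + 1, Runs P R (Prog.clear k) σ t
      { σ with stk := fun s => if s < k then [] else σ.stk s } := by
  induction k with
  | zero =>
    refine ⟨1, by simp, ?_⟩
    simp only [Nat.not_lt_zero, if_false]
    exact .skip σ
  | succ k ih =>
    obtain ⟨t, ht, hr⟩ := ih fun s hs => hH s (by omega)
    set σ₁ : MState I := { σ with stk := fun s => if s < k then [] else σ.stk s }
    have hpop := runs_popAll (P := P) (R := R) k (σ.stk k) σ₁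
    rw [σ₁.setStk_eq_self (by simp [σ₁])] at hpop
    have h_final : σ₁.setStk k [] =
        { σ with stk := fun s => if s < k + 1 then [] else σ.stk s } := by
      unfold MState.setStk
      congr 1
      funext s
      rcases lt_trichotomy s k with h | rfl | h
      · simp [σ₁, h, h.ne, h.trans (Nat.lt_succ_self k)]
      · simp
      · simp [σ₁, h.ne', h.not_gt, (Nat.succ_le_of_lt h).not_gt]
    refine ⟨t + (2 * (σ.stk k).length + 1), ?_, h_final ▸ .seq _ _ _ _ _ _ _ hr hpop⟩
    have := hH k (by omega)
    calc t + (2 * (σ.stk k).length + 1) ≤ (k * (2 * H + 1) + 1) + (2 * H + 1) := by omega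
      _ = (k + 1) * (2 * H + 1) + 1 := by ring

theorem runs_clear_eq_blank {c H : ℕ} {σ : MState I} (hH : ∀ s, (σ.stk s).length ≤ H)
    (hσ : ∀ s, c < s → σ.stk s = []) :
    ∃ t ≤ (c + 1) * (2 * H + 1) + 1,
      Runs P R (Prog.clear (c + 1)) σ t (MState.blank σ.val σ.drawn) := by
  obtain ⟨t, ht, hr⟩ := runs_clear (P := P) (R := R) (c + 1) σ fun s _ => hH s
  refine ⟨t, ht, ?_⟩
  convert hr using 1
  simp only [MState.blank, MState.mk.injEq, and_self, and_true]
  funext s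
  split_ifs with h
  · rfl
  · exact (hσ s (by omega)).symm

/-- The bit vector of a set of variables, in the form in which `FindsCoreEvent` reports it. -/
def bitVector {n : ℕ} (S : Finset (Fin n)) : List Bool :=
  List.ofFn fun i => decide (i ∈ S)

theorem drop_bitVector_length {n : ℕ} (S : Finset (Fin n)) : (bitVector S).drop n = [] := by
  simp [bitVector]

theorem drop_bitVector_of_lt {n : ℕ} (S : Finset (Fin n)) {k : ℕ} (hk : k < n) :
    (bitVector S).drop k = decide (⟨k, hk⟩ ∈ S) :: (bitVector S).drop (k + 1) := by
  rw [List.drop_eq_getElem_cons (by simpa [bitVector] using hk)]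
  simp [bitVector]

namespace MState

/-- The state reached from `σ` by `Prog.resample` when it has treated the first `k` entries of the
bit vector of `S`. -/
def resampling (R : I.Table) (S : Finset (Fin I.n)) (c : ℕ) (σ : MState I) (k : ℕ) : MState I :=
  ((σ.drawSet R {i ∈ S | i.1 < k}).setStk 1 ((bitVector S).drop k)).setStk c (List.replicate k true)

variable {S : Finset (Fin I.n)} {c k : ℕ}

theorem resampling_stk_one (hc : c ≠ 1) (σ : MState I) :
    (σ.resampling R S c k).stk 1 = (bitVector S).drop k := by
  rw [resampling, setStk_stk_of_ne _ _ hc.symm, setStk_stk_self]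

theorem drawSet_filter_lt_succ (σ : MState I) (hk : k < I.n) :
    σ.drawSet R {i ∈ S | i.1 < k + 1} =
      if ⟨k, hk⟩ ∈ S then (σ.drawSet R {i ∈ S | i.1 < k}).draw R k
      else σ.drawSet R {i ∈ S | i.1 < k} := by
  split_ifs with h
  · rw [← drawSet_insert (i := ⟨k, hk⟩) σ (by simp)]
    congr 1
    ext i
    have : i.1 < k + 1 ↔ i = ⟨k, hk⟩ ∨ i.1 < k := by
      rw [Nat.lt_succ_iff_lt_or_eq, Fin.ext_iff, or_comm]
    simp only [Finset.mem_filter, Finset.mem_insert, this]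
    aesop
  · congr 1
    refine Finset.filter_congr fun i hi => ?_
    have : i.1 ≠ k := fun e => h (by rwa [← Fin.ext (a := i) (b := ⟨k, hk⟩) e])
    omega

end MState

theorem runs_resample_step {c : ℕ} (hc : c ≠ 1) (S : Finset (Fin I.n)) (σ : MState I) {k : ℕ}
    (hk : k < I.n) :
    Runs P R (.seq (.ite (.top 1) (.sample c) .skip) (.seq (.pop 1) (.push c true)))
      (σ.resampling R S c k) 4 (σ.resampling R S c (k + 1)) := by
  have h_stk := σ.resampling_stk_one (R := R) (S := S) (k := k) hc
  rw [drop_bitVector_of_lt S hk] at h_stk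
  have h_ite : Runs P R (.ite (.top 1) (.sample c) .skip) (σ.resampling R S c k) 2
      (((σ.drawSet R {i ∈ S | i.1 < k + 1}).setStk 1 ((bitVector S).drop k)).setStk c
        (List.replicate k true)) := by
    rw [MState.drawSet_filter_lt_succ σ hk]
    split_ifs with h
    · convert Runs.iteTrue _ _ .skip _ _ 1 _ (.sample c (σ.resampling R S c k)) using 1
      · simp [MState.resampling, MState.draw_setStk]
      · simp [StackTest.eval, h_stk, h]
    · exact .iteFalse _ _ _ _ _ 1 (by simp [StackTest.eval, h_stk, h]) (.skip _)
  convert Runs.seq _ _ _ _ _ _ _ h_ite (.seq _ _ _ _ _ _ _ (.pop 1 _) (.push c true _)) using 1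
  simp [MState.resampling, MState.pushOpt, MState.setStk_comm _ hc, MState.setStk_stk_of_ne,
    hc.symm, List.replicate_succ]

theorem runs_resample_from {c : ℕ} (hc : c ≠ 1) (S : Finset (Fin I.n)) (σ : MState I) (m : ℕ)
    {k : ℕ} (hk : k + m = I.n) :
    Runs P R (.resample c) (σ.resampling R S c k) (5 * m + 1) (σ.resampling R S c I.n) := by
  induction m generalizing k with
  | zero =>
    obtain rfl : k = I.n := by omega
    exact .whileFalse _ _ _
      (by simp [StackTest.eval, MState.resampling_stk_one hc, drop_bitVector_length])
  | succ m ih =>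
    have hk' : k < I.n := by omega
    refine Runs.while_step ?_ (runs_resample_step hc S σ hk') (ih (k := k + 1) (by omega)) (by ring)
    simp [StackTest.eval, MState.resampling_stk_one hc, drop_bitVector_of_lt S hk']

theorem runs_resample {c : ℕ} (hc : c ≠ 1) {S : Finset (Fin I.n)} {σ : MState I}
    (h₁ : σ.stk 1 = bitVector S) (h_c : σ.stk c = []) :
    Runs P R (.resample c) σ (5 * I.n + 1)
      (((σ.drawSet R S).setStk 1 []).setStk c (List.replicate I.n true)) := by
  convert runs_resample_from (P := P) (R := R) hc S σ I.n (zero_add _) using 1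
  · simp [MState.resampling, MState.drawSet_empty, MState.setStk_eq_self, h₁, h_c]
  · simp [MState.resampling, drop_bitVector_length]

/-- The state reached from `σ` by `Prog.allVars` when it has counted `k` variables. -/
def MState.counting (c : ℕ) (σ : MState I) (k : ℕ) : MState I :=
  (σ.setStk 1 (decide (k < I.n) :: List.replicate k true)).setStk c (List.replicate k true)

theorem runs_count_step {c : ℕ} (hc : c ≠ 1) (σ : MState I) {k : ℕ} (hk : k < I.n) :
    Runs P R (.seq (.push c true) (.isVar 1 c)) (σ.counting c k) 2 (σ.counting c (k + 1)) := by
  convert Runs.seq _ _ _ _ _ _ _ (.push c true (σ.counting c k)) (.isVar 1 c _) using 1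
  simp [MState.counting, MState.pushOpt, MState.setStk_comm _ hc, MState.setStk_stk_of_ne,
    hc.symm, hk, List.replicate_succ]

theorem runs_count {c : ℕ} (hc : c ≠ 1) (σ : MState I) (m : ℕ) {k : ℕ} (hk : k + m = I.n) :
    Runs P R (.while (.top 1) (.seq (.push c true) (.isVar 1 c))) (σ.counting c k) (3 * m + 1)
      (σ.counting c I.n) := by
  have h_test (k : ℕ) : StackTest.eval (σ.counting c k) (.top 1) = decide (k < I.n) := by
    simp [StackTest.eval, MState.counting, MState.setStk_stk_of_ne _ _ hc.symm]
  induction m generalizing k with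
  | zero =>
    obtain rfl : k = I.n := by omega
    exact .whileFalse _ _ _ (by simp [h_test])
  | succ m ih =>
    have hk' : k < I.n := by omega
    exact .while_step (by simp [h_test, hk']) (runs_count_step hc σ hk') (ih (by omega)) (by ring)

theorem runs_allVars {c : ℕ} (hc : c ≠ 1) (ω : I.Assignment) (d : Fin I.n → ℕ) :
    Runs P R (.allVars c) (.blank ω d) (5 * I.n + 4)
      ((MState.blank ω d).setStk 1 (bitVector (Finset.univ : Finset (Fin I.n)))) := by
  set σ : MState I := .blank ω d
  have h_init : Runs P R (.isVar 1 c) σ 1 (σ.counting c 0) := by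
    convert Runs.isVar 1 c σ using 1
    simp [MState.counting, MState.pushOpt, σ, MState.blank, MState.setStk_eq_self,
      MState.setStk_stk_of_ne _ _ hc]
  have h_pop : Runs P R (.pop 1) (σ.counting c I.n) 1
      ((σ.setStk 1 (bitVector (Finset.univ : Finset (Fin I.n)))).setStk c
        (List.replicate I.n true)) := by
    convert Runs.pop 1 (σ.counting c I.n) using 1
    simp [MState.counting, bitVector, MState.setStk_comm _ hc, MState.setStk_stk_of_ne, hc.symm]
  have h_clear := runs_popAll (P := P) (R := R) c (List.replicate I.n true)
    (σ.setStk 1 (bitVector (Finset.univ : Finset (Fin I.n))))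
  rw [List.length_replicate, MState.setStk_eq_self (s := c) (L := []) _
    (MState.setStk_stk_of_ne _ _ hc)] at h_clear
  rw [show 5 * I.n + 4 = 1 + (3 * I.n + 1 + (1 + (2 * I.n + 1))) by ring]
  exact .seq _ _ _ _ _ _ _ h_init (.seq _ _ _ _ _ _ _ (runs_count hc σ I.n (zero_add _))
    (.seq _ _ _ _ _ _ _ h_pop h_clear))

/-- The state of the machine when the events in `l` have been resampled and a program that changes
only stacks below `c` has then looked, for at most `H` steps, for a core event that holds. -/
structure Checked (R : I.Table) (c H : ℕ) (l : List I.J) (σ : MState I) : Prop where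
  val_eq : σ.val = I.current R l
  drawn_eq : σ.drawn = fun i => I.resampleCount l i + 1
  stk_eq_nil : ∀ s, c ≤ s → σ.stk s = []
  length_stk_le : ∀ s, (σ.stk s).length ≤ H
  answer : (∃ j ∈ I.core, I.current R l ∈ I.event j ∧ StackTest.eval σ (.top 0) = true ∧
      σ.stk 1 = bitVector (I.vbl j)) ∨
    ((∀ j ∈ I.core, I.current R l ∉ I.event j) ∧ StackTest.eval σ (.top 0) = false)

/-- A bound for the running time of `V.round c` from stacks of height at most `H + n`, if `V` takes
at most `H` steps. -/
def roundTime (n c H : ℕ) : ℕ :=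
  (5 * n + 1) + (((c + 1) * (2 * (H + n) + 1) + 1) + H)

variable {V : Prog} {c H : ℕ}

theorem FindsCoreEvent.exists_runs_checked (hV : FindsCoreEvent P V H) (hVc : V.bound ≤ c)
    (l : List I.J) :
    ∃ t ≤ H, ∃ σ,
      Runs P R V (.blank (I.current R l) fun i => I.resampleCount l i + 1) t σ ∧
      Checked R c H l σ := by
  obtain ⟨t, σ, ht, hr, hval, hdrawn, h_answer⟩ :=
    hV R (I.current R l) fun i => I.resampleCount l i + 1
  refine ⟨t, ht, σ, hr, hval, hdrawn, fun s hs => hr.stk_eq (hVc.trans hs), fun s => ?_, ?_⟩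
  · have := hr.length_stk_le s
    rw [MState.blank, List.length_nil] at this
    omega
  · simpa [StackTest.eval, bitVector] using h_answer

theorem runs_round (hV : FindsCoreEvent P V H) (hVc : V.bound ≤ c) (hc : 2 ≤ c) {σ : MState I}
    (h_nil : ∀ s, c ≤ s → σ.stk s = []) (h_len : ∀ s, (σ.stk s).length ≤ H + I.n)
    {S : Finset (Fin I.n)} (h_S : σ.stk 1 = bitVector S) {l : List I.J}
    (h_val : (σ.drawSet R S).val = I.current R l)
    (h_drawn : (σ.drawSet R S).drawn = fun i => I.resampleCount l i + 1) :
    ∃ t ≤ roundTime I.n c H, ∃ σ', Runs P R (V.round c) σ t σ' ∧ Checked R c H l σ' := by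
  have hr₁ := runs_resample (P := P) (R := R) (by omega) h_S (h_nil c le_rfl)
  set σ₁ : MState I := ((σ.drawSet R S).setStk 1 []).setStk c (List.replicate I.n true)
  have h_stk (s : ℕ) (h₁ : s ≠ 1) (h_c : s ≠ c) : σ₁.stk s = σ.stk s := by
    rw [MState.setStk_stk_of_ne _ _ h_c, MState.setStk_stk_of_ne _ _ h₁, MState.drawSet]
  have h_len₁ (s : ℕ) : (σ₁.stk s).length ≤ H + I.n := by
    rcases eq_or_ne s c with rfl | h_c
    · simp [σ₁]
    rcases eq_or_ne s 1 with rfl | h₁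
    · simp [σ₁, MState.setStk_stk_of_ne _ _ h_c]
    · exact h_stk s h₁ h_c ▸ h_len s
  obtain ⟨t₂, ht₂, hr₂⟩ := runs_clear_eq_blank (P := P) (R := R) h_len₁
    fun s hs => (h_stk s (by omega) (by omega)).trans (h_nil s hs.le)
  rw [show σ₁.val = _ from h_val, show σ₁.drawn = _ from h_drawn] at hr₂
  obtain ⟨t₃, ht₃, σ', hr₃, hσ'⟩ := hV.exists_runs_checked (R := R) hVc l
  exact ⟨_, by unfold roundTime; omega, σ', .seq _ _ _ _ _ _ _ hr₁ (.seq _ _ _ _ _ _ _ hr₂ hr₃),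
    hσ'⟩

theorem Checked.runs_round (hV : FindsCoreEvent P V H) (hVc : V.bound ≤ c) (hc : 2 ≤ c)
    {l : List I.J} {σ : MState I} (hσ : Checked R c H l σ) {j : I.J}
    (hj : σ.stk 1 = bitVector (I.vbl j)) :
    ∃ t ≤ roundTime I.n c H, ∃ σ', Runs P R (V.round c) σ t σ' ∧ Checked R c H (j :: l) σ' :=
  _root_.runs_round hV hVc hc hσ.stk_eq_nil (fun s => (hσ.length_stk_le s).trans (by omega)) hj
    (σ.drawSet_vbl_val hσ.val_eq hσ.drawn_eq) (σ.drawSet_vbl_drawn hσ.drawn_eq)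

theorem runs_first_round (hV : FindsCoreEvent P V H) (hVc : V.bound ≤ c) (hc : 2 ≤ c)
    (ω : I.Assignment) :
    ∃ t ≤ roundTime I.n c H, ∃ σ, Runs P R (V.round c)
      ((MState.blank ω fun _ => 0).setStk 1 (bitVector (Finset.univ : Finset (Fin I.n)))) t σ ∧
      Checked R c H [] σ := by
  have h_stk (s : ℕ) (hs : s ≠ 1) : ((MState.blank ω fun _ => 0).setStk 1
      (bitVector (Finset.univ : Finset (Fin I.n)))).stk s = [] := MState.setStk_stk_of_ne _ _ hs
  refine runs_round hV hVc hc (fun s hs => h_stk s (by omega)) (fun s => ?_)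
    (MState.setStk_stk_self _ _ _) ?_ ?_
  · rcases eq_or_ne s 1 with rfl | hs
    · simp [bitVector]
    · simp [h_stk s hs]
  · funext i
    exact if_pos (Finset.mem_univ i)
  · funext i
    exact if_pos (Finset.mem_univ i)

theorem runs_loop (hV : FindsCoreEvent P V H) (hVc : V.bound ≤ c) (hc : 2 ≤ c) {N : ℕ}
    (hN : ∀ l, I.IsLog R l → l.length ≤ N) (m : ℕ) {l : List I.J} (hm : N < l.length + m)
    (hl : I.IsLog R l) {σ : MState I} (hσ : Checked R c H l σ) :
    ∃ (l' : List I.J) (t : ℕ) (σ' : MState I), I.IsFinalLog R l' ∧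
      Runs P R (.while (.top 0) (V.round c)) σ t σ' ∧ σ'.val = I.current R l' ∧
      t + (1 + roundTime I.n c H) * l.length ≤ (1 + roundTime I.n c H) * l'.length + 1 := by
  induction m generalizing l σ with
  | zero => exact absurd (hN l hl) (by omega)
  | succ m ih =>
    rcases hσ.answer with ⟨j, hj, h_event, h_top, h_bits⟩ | ⟨h_none, h_top⟩
    · obtain ⟨t₁, ht₁, σ₁, hr₁, hσ₁⟩ := hσ.runs_round hV hVc hc h_bits
      obtain ⟨l', t, σ', h_final, hr, h_val, ht⟩ :=
        ih (by rw [List.length_cons]; omega) (.cons l j hl hj h_event) hσ₁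
      refine ⟨l', _, σ', h_final, .while_step h_top hr₁ hr rfl, h_val, ?_⟩
      rw [List.length_cons, mul_add, mul_one] at ht
      omega
    · exact ⟨l, 1, σ, ⟨hl, h_none⟩, .whileFalse _ _ _ h_top, hσ.val_eq, by omega⟩

theorem exists_length_le_of_resamplings_lt_top (h : I.resamplings R < ⊤) :
    ∃ N : ℕ, ∀ l, I.IsLog R l → l.length ≤ N := by
  obtain ⟨N, hN⟩ := ENat.ne_top_iff_exists.1 h.ne
  refine ⟨N, fun l hl => ?_⟩
  have : (l.length : ℕ∞) ≤ I.resamplings R :=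
    le_iSup (fun l : {l : List I.J // I.IsLog R l} => (l.1.length : ℕ∞)) ⟨l, hl⟩
  rw [← hN] at this
  exact_mod_cast this

theorem runs_moserTardos (hV : FindsCoreEvent P V H) (hVc : V.bound ≤ c) (hc : 2 ≤ c)
    (h : I.resamplings R < ⊤) (ω : I.Assignment) :
    ∃ (l : List I.J) (t : ℕ) (σ : MState I), I.IsFinalLog R l ∧
      Runs P R (V.moserTardos c) (.blank ω fun _ => 0) t σ ∧ σ.val = I.current R l ∧
      t ≤ (5 * I.n + 5 + roundTime I.n c H) * (l.length + 1) := by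
  obtain ⟨N, hN⟩ := exists_length_le_of_resamplings_lt_top h
  have hr₀ := runs_allVars (P := P) (R := R) (c := c) (by omega) ω fun _ => 0
  obtain ⟨t₁, ht₁, σ₁, hr₁, hσ₁⟩ := runs_first_round (R := R) hV hVc hc ω
  obtain ⟨l, t, σ, h_final, hr, h_val, ht⟩ :=
    runs_loop hV hVc hc hN (N + 1) (by rw [List.length_nil]; omega) .nil hσ₁
  refine ⟨l, _, σ, h_final, .seq _ _ _ _ _ _ _ hr₀ (.seq _ _ _ _ _ _ _ hr₁ hr), h_val, ?_⟩
  rw [List.length_nil, mul_zero, add_zero] at ht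
  calc 5 * I.n + 4 + (t₁ + t)
      ≤ (5 * I.n + 5 + roundTime I.n c H) + (1 + roundTime I.n c H) * l.length := by omega
    _ ≤ (5 * I.n + 5 + roundTime I.n c H) + (5 * I.n + 5 + roundTime I.n c H) * l.length := by
        gcongr
        omega
    _ = (5 * I.n + 5 + roundTime I.n c H) * (l.length + 1) := by ring

theorem EfficientlyVerifiable.efficientlyImplementable {ι : Type w} {F : ι → LLLInstance.{u, v}}
    {P : ∀ a, Presentation (F a)} {size : ι → ℕ} (hn : ∀ a, (F a).n ≤ size a)
    (h : EfficientlyVerifiable F P size) : EfficientlyImplementable F P size := by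
  obtain ⟨V, p, hV⟩ := h
  let c := max V.bound 2
  refine ⟨V.moserTardos c, 5 * Polynomial.X + 5 + ((5 * Polynomial.X + 1) +
    ((Polynomial.C (c + 1) * (2 * (p + Polynomial.X) + 1) + 1) + p)), fun a R ω hR => ?_⟩
  obtain ⟨l, t, σ, h_final, hr, h_val, ht⟩ :=
    runs_moserTardos (hV a) (le_max_left V.bound 2) (le_max_right V.bound 2) hR ω
  refine ⟨l, t, σ, h_final, hr, h_val, ht.trans (Nat.mul_le_mul_right _ ?_)⟩
  simp only [roundTime, Polynomial.eval_add, Polynomial.eval_mul, Polynomial.eval_ofNat,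
    Polynomial.eval_X, Polynomial.eval_C, Polynomial.eval_one]
  gcongr <;> exact hn a

end Machine

theorem theorem3p3_general :
    (∀ (ι : Type w) (F : ι → LLLInstance.{u, v}) (P : ∀ a, Presentation (F a)) (size : ι → ℕ),
      (∀ a, (F a).n ≤ size a) → EfficientlyVerifiable F P size →
      EfficientlyImplementable F P size) ∧
    ∃ C : ℝ, 0 < C ∧
      ∀ (I : LLLInstance.{u, v}) (ε : ℝ) (x : I.J → ℝ), 0 ≤ ε → ε < 1 →
        (∀ j, 0 < x j ∧ x j < 1) →
        (∀ j, I.probOf j ≤ (1 - ε) * x j * ∏ k ∈ I.coreNbr j, (1 - x k)) →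
        ((∀ j ∈ I.core, (I.vbl j).Nonempty) →
          I.T x ≤ I.n * max 1 (Real.logb 2 (1 / I.δ x))) ∧
        (∫⁻ R, (I.resamplings R : ℝ≥0∞) ∂I.tableLaw ≤ ENNReal.ofReal (I.v₁ x) ∧
          ∀ r : ℝ, 1 ≤ r →
            1 - 1 / r ≤ I.tableLaw.real
              {R | (I.resamplings R : ℝ≥0∞) ≤ ENNReal.ofReal (r * I.v₁ x)}) ∧
        (0 < ε →
          ∫⁻ R, (I.resamplings R : ℝ≥0∞) ∂I.tableLaw ≤ ENNReal.ofReal (C * I.v₂ x ε) ∧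
          ∀ r : ℝ, 1 ≤ r →
            1 - Real.exp (-r) ≤ I.tableLaw.real
              {R | (I.resamplings R : ℝ≥0∞) ≤ ENNReal.ofReal (r * (C * I.v₂ x ε))}) ∧
        1 - ∑ j ∈ I.nonCore, x j ≤ I.tableLaw.real I.successSet := by
  refine ⟨fun ι F P size hn hV => hV.efficientlyImplementable hn, 12, by norm_num,
    fun I ε x hε₀ hε₁ hx h => ?_⟩
  have h_no_slack (j) : I.probOf j ≤ x j * ∏ k ∈ I.coreNbr j, (1 - x k) :=
    LLLInstance.probOf_le_of_slack hx hε₀ (h j)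
  exact ⟨LLLInstance.T_le hx,
    ⟨LLLInstance.lintegral_resamplings_le_v₁ hx fun j _ => h_no_slack j,
      fun r hr => LLLInstance.one_sub_one_div_le_tableLaw_resamplings_le hx
        (fun j _ => h_no_slack j) (by linarith)⟩,
    fun hε => ⟨LLLInstance.lintegral_resamplings_le_v₂ hx hε hε₁ fun j _ => h j,
      fun r hr => LLLInstance.one_sub_exp_neg_le_tableLaw_resamplings_le hx hε hε₁
        (fun j _ => h j) hr⟩,
    LLLInstance.one_sub_sum_nonCore_le_tableLaw_successSet hx h_no_slack⟩

theorem theorem3p3 :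
    ∃ C : ℝ, 0 < C ∧
      ∀ (ι : Type w) (F : ι → LLLInstance.{u, v}) (P : ∀ a, Presentation (F a)) (size : ι → ℕ),
        (∀ a, (F a).n ≤ size a) → EfficientlyVerifiable F P size →
        EfficientlyImplementable F P size ∧
        ∀ (a : ι) (ε : ℝ) (x : (F a).J → ℝ), 0 ≤ ε → ε < 1 → (∀ j, 0 < x j ∧ x j < 1) →
          (∀ j, (F a).probOf j ≤ (1 - ε) * x j * ∏ k ∈ (F a).coreNbr j, (1 - x k)) →
          ((∀ j ∈ (F a).core, ((F a).vbl j).Nonempty) →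
            (F a).T x ≤ (F a).n * max 1 (Real.logb 2 (1 / (F a).δ x))) ∧
          (ε = 0 →
            ∫⁻ R, ((F a).resamplings R : ℝ≥0∞) ∂(F a).tableLaw ≤ ENNReal.ofReal ((F a).v₁ x) ∧
            ∀ r : ℝ, 1 ≤ r →
              1 - 1 / r ≤ (F a).tableLaw.real
                {R | ((F a).resamplings R : ℝ≥0∞) ≤ ENNReal.ofReal (r * (F a).v₁ x)}) ∧
          (0 < ε →
            ∫⁻ R, ((F a).resamplings R : ℝ≥0∞) ∂(F a).tableLaw ≤
              ENNReal.ofReal (C * (F a).v₂ x ε) ∧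
            ∀ r : ℝ, 1 ≤ r →
              1 - Real.exp (-r) ≤ (F a).tableLaw.real
                {R | ((F a).resamplings R : ℝ≥0∞) ≤ ENNReal.ofReal (r * (C * (F a).v₂ x ε))}) ∧
          1 - ∑ j ∈ (F a).nonCore, x j ≤ (F a).tableLaw.real (F a).successSet := by
  obtain ⟨h_impl, C, hC, h⟩ := theorem3p3_general.{u, v, w}
  exact ⟨C, hC, fun ι F P size hn hV => ⟨h_impl ι F P size hn hV, fun a ε x hε₀ hε₁ hx hj =>
    (h (F a) ε x hε₀ hε₁ hx hj).imp_right (And.imp_left fun h _ => h)⟩⟩
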